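/- Let $d\ge 2$ and let $G=\mathrm{SO}^+(d,1)$ be the group of orientation preserving isometries of hyperbolic $d$-space. Let $A=\{a_t\}_{t\in\mathbb R}$ be the Cartan subgroup (the one-parameter group of boosts in a fixed direction, parametrized so that conjugation $u\mapsto a_tua_{-t}$ expands $U$ by the factor $e^t$), $U=\{u\in G: a_{-t}ua_t\to e \text{ as } t\to\infty\}$ the unstable horospherical subgroup, $K\cong\mathrm{SO}(d)$ the maximal compact subgroup of orthogonal matrices in $G$, $M=Z_K(A)$ and $Q=UMA$. Identify $S^{d-1}$ with $Q\backslash G$, on which $G$ acts by right multiplication, and let $\pi_-(g)=Qg$. For $\xi\in Q\backslash G$ and $g,h\in G$ choose $g_\xi\in Kg$ with $\pi_-(g_\xi)=\xi$ and define the Busemann function $b_\xi(g,h)\in\mathbb R$ by the $KAU$-decomposition $hg_\xi^{-1}=k\,a_{b_\xi(g,h)}\,u$ with $k\in K$, $u\in U$. For a subgroup $\Gamma<G$ and $\beta\in\mathbb R$, a measure $\nu$ on $S^{d-1}$ is called $\Gamma$-conformal with parameter $\beta$ if for every $\gamma\in\Gamma$ \[ \frac{d\gamma_*\nu}{d\nu}(\xi)=e^{-\beta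 b_\xi(\gamma^{-1},e)}, \] where $\gamma_*\nu$ is the image of $\nu$ under $\xi\mapsto\xi\gamma^{-1}$. A Borel section is a Borel map $s:S^{d-1}\to G$ with $s(\xi)\in K$ and $\pi_-(s(\xi))=\xi$ for all $\xi$; it gives coordinates $(u,m,a_t,\xi)\mapsto u\,m\,a_t\,s(\xi)$ from $U\times M\times A\times S^{d-1}$ to $G$. Fix Haar measures $du$ on $U$ and $dm$ on $M$, and let $dt$ be Lebesgue measure. Let $\Gamma<G$ be a discrete subgroup and let $\mu$ be a $U$-invariant and $U$-ergodic Radon (locally finite Borel) measure on $G/\Gamma$ which is $MA$-quasi-invariant, that is, $(ma_t)_*\mu$ and $\mu$ are mutually absolutely continuous for all $m\in M$ and $t\in\mathbb R$. Then Borel sections exist, and there are $\beta\in\mathbb R$, a finite $\Gamma$-conformal measure $\nu$ with parameter $\beta$ on $S^{d-1}$, and a measure $\tilde\mu$ on $G$ such that: (i) $\mu$ is induced by $\tilde\mu$, i.e. $\int_G f\,d\tilde\mu=\int_{G/\Gamma}\sum_{g\in x}f(g)\,d\mu(x)$ for every Borel $f:G\to[0,\infty]$, where $x\in G/\Gamma$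 is viewed as a coset in $G$; (ii) in the $U\times M\times A\times S^{d-1}$ coordinates given by any Borel section, \[ d\tilde\mu=e^{\beta t}\,d\nu\,dm\,dt\,du . \] -/

import Mathlib

open MeasureTheory Filter Topology

noncomputable section

namespace HoroMeasure

/-- Index set of the coordinates of `ℝ^(d+1)`, for `d ≥ 1`: the `d - 1` space-like coordinates
`Sum.inl i`, one more space-like coordinate `Sum.inr 0` (the direction of the geodesic flow), and
the time-like coordinate `Sum.inr 1`. -/
abbrev Idx (d : ℕ) : Type := Fin (d - 1) ⊕ Fin 2

/-- The Lorentz form of signature `(d, 1)`. -/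
def lorentz (d : ℕ) : Matrix (Idx d) (Idx d) ℝ :=
  Matrix.diagonal (Sum.elim (fun _ => 1) ![1, -1])

lemma lorentz_mul_self (d : ℕ) : lorentz d * lorentz d = 1 := by
  unfold lorentz
  rw [Matrix.diagonal_mul_diagonal, ← Matrix.diagonal_one]
  congr 1
  funext i
  rcases i with i | i
  · simp
  · fin_cases i <;> simp

lemma lorentz_flip {d : ℕ} {g : Matrix (Idx d) (Idx d) ℝ}
    (h : g.transpose * lorentz d * g = lorentz d) :
    g * lorentz d * g.transpose = lorentz d := by
  have h1 : (lorentz d * g.transpose * lorentz d) * g = 1 := by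
    rw [← lorentz_mul_self d]
    nth_rewrite 4 [← h]
    simp only [Matrix.mul_assoc]
  have h2 : g * (lorentz d * g.transpose * lorentz d) = 1 := mul_eq_one_comm.mp h1
  calc g * lorentz d * g.transpose
      = g * (lorentz d * g.transpose * lorentz d) * lorentz d := by
        simp only [Matrix.mul_assoc, lorentz_mul_self, Matrix.mul_one]
    _ = lorentz d := by rw [h2, Matrix.one_mul]

lemma time_col {d : ℕ} {g : Matrix (Idx d) (Idx d) ℝ}
    (h : g.transpose * lorentz d * g = lorentz d) :
    ∑ i, g (Sum.inl i) (Sum.inr 1) ^ 2 + g (Sum.inr 0) (Sum.inr 1) ^ 2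
      = g (Sum.inr 1) (Sum.inr 1) ^ 2 - 1 := by
  have h1 := congrFun (congrFun h (Sum.inr 1)) (Sum.inr 1)
  rw [Matrix.mul_apply] at h1
  simp [lorentz, Matrix.mul_diagonal, Fintype.sum_sum_type] at h1
  have h2 : ∑ i, g (Sum.inl i) (Sum.inr 1) ^ 2
      = ∑ i, g (Sum.inl i) (Sum.inr 1) * g (Sum.inl i) (Sum.inr 1) :=
    Finset.sum_congr rfl fun i _ => by ring
  rw [h2]
  nlinarith

lemma time_mul_pos {d : ℕ} {g h : Matrix (Idx d) (Idx d) ℝ}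
    (hg : g.transpose * lorentz d * g = lorentz d) (hg0 : 0 < g (Sum.inr 1) (Sum.inr 1))
    (hh : h.transpose * lorentz d * h = lorentz d) (hh0 : 0 < h (Sum.inr 1) (Sum.inr 1)) :
    0 < (g * h) (Sum.inr 1) (Sum.inr 1) := by
  have hg' : (g.transpose).transpose * lorentz d * g.transpose = lorentz d := by
    rw [Matrix.transpose_transpose]; exact lorentz_flip hg
  have e1 := time_col hg'
  have e2 := time_col hh
  simp only [Matrix.transpose_apply] at e1
  have cs := Finset.sum_mul_sq_le_sq_mul_sq Finset.univ
    (fun i : Fin (d - 1) ⊕ Unit => Sum.elim (fun i => g (Sum.inr 1) (Sum.inl i))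
      (fun _ => g (Sum.inr 1) (Sum.inr 0)) i)
    (fun i : Fin (d - 1) ⊕ Unit => Sum.elim (fun i => h (Sum.inl i) (Sum.inr 1))
      (fun _ => h (Sum.inr 0) (Sum.inr 1)) i)
  simp only [Fintype.sum_sum_type, Sum.elim_inl, Sum.elim_inr, Finset.univ_unique,
    Finset.sum_singleton] at cs
  rw [e1, e2] at cs
  rw [Matrix.mul_apply, Fintype.sum_sum_type, Fin.sum_univ_two]
  set x := g (Sum.inr 1) (Sum.inr 1)
  set y := h (Sum.inr 1) (Sum.inr 1)
  set w := ∑ i, g (Sum.inr 1) (Sum.inl i) * h (Sum.inl i) (Sum.inr 1)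
    + g (Sum.inr 1) (Sum.inr 0) * h (Sum.inr 0) (Sum.inr 1) with hw
  have hx1 : 0 ≤ x ^ 2 - 1 := by rw [← e1]; positivity
  have hy1 : 0 ≤ y ^ 2 - 1 := by rw [← e2]; positivity
  have hxy : w ^ 2 < (x * y) ^ 2 := by nlinarith
  have := abs_lt_of_sq_lt_sq hxy (by positivity)
  have := (abs_lt.mp this).1
  linarith

/-- `SO⁺(d,1)`: real matrices of determinant one which preserve the Lorentz form and the
direction of time. -/
def SOplus (d : ℕ) : Subgroup (Matrix.SpecialLinearGroup (Idx d) ℝ) where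
  carrier := {g | (g : Matrix (Idx d) (Idx d) ℝ).transpose * lorentz d * g = lorentz d ∧
    0 < (g : Matrix (Idx d) (Idx d) ℝ) (Sum.inr 1) (Sum.inr 1)}
  one_mem' := by simp
  mul_mem' := by
    rintro a b ⟨ha, ha0⟩ ⟨hb, hb0⟩
    refine ⟨?_, ?_⟩
    · rw [Matrix.SpecialLinearGroup.coe_mul, Matrix.transpose_mul]
      calc _ = (b : Matrix (Idx d) (Idx d) ℝ).transpose *
            ((a : Matrix (Idx d) (Idx d) ℝ).transpose * lorentz d * a) * b := by
            simp only [Matrix.mul_assoc]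
        _ = _ := by rw [ha, hb]
    · rw [Matrix.SpecialLinearGroup.coe_mul]
      exact time_mul_pos ha ha0 hb hb0
  inv_mem' := by
    rintro a ⟨ha, ha0⟩
    have h1 : (lorentz d * (a : Matrix (Idx d) (Idx d) ℝ).transpose * lorentz d) * a = 1 := by
      rw [← lorentz_mul_self d]
      nth_rewrite 4 [← ha]
      simp only [Matrix.mul_assoc]
    have h2 : ((a⁻¹ : Matrix.SpecialLinearGroup (Idx d) ℝ) : Matrix (Idx d) (Idx d) ℝ)
        = lorentz d * (a : Matrix (Idx d) (Idx d) ℝ).transpose * lorentz d := by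
      have h3 : (a : Matrix (Idx d) (Idx d) ℝ) *
          ((a⁻¹ : Matrix.SpecialLinearGroup (Idx d) ℝ) : Matrix (Idx d) (Idx d) ℝ) = 1 := by
        rw [← Matrix.SpecialLinearGroup.coe_mul, mul_inv_cancel,
          Matrix.SpecialLinearGroup.coe_one]
      exact (left_inv_eq_right_inv h1 h3).symm
    refine ⟨?_, ?_⟩
    · rw [h2]
      have h4 := lorentz_flip ha
      have h5 : (lorentz d).transpose = lorentz d := by simp [lorentz]
      simp only [Matrix.transpose_mul, Matrix.transpose_transpose, h5]
      calc _ = lorentz d * ((a : Matrix (Idx d) (Idx d) ℝ) * (lorentz d * (lorentz d * lorentz d)) *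
            (a : Matrix (Idx d) (Idx d) ℝ).transpose) * lorentz d := by
            simp only [Matrix.mul_assoc]
        _ = _ := by rw [lorentz_mul_self, Matrix.mul_one, h4, lorentz_mul_self, Matrix.one_mul]
    · rw [h2]
      simpa [lorentz, Matrix.diagonal_mul, Matrix.mul_diagonal] using ha0

/-- `G = SO⁺(d,1)` as a topological group (with the topology of matrix entries). -/
abbrev G (d : ℕ) : Type := ↥(SOplus d)

instance (d : ℕ) : MeasurableSpace (G d) := borel (G d)

instance (d : ℕ) : BorelSpace (G d) := ⟨rfl⟩

/-- The underlying matrix of an element of `G`. -/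
def mat {d : ℕ} (g : G d) : Matrix (Idx d) (Idx d) ℝ :=
  ((g : Matrix.SpecialLinearGroup (Idx d) ℝ) : Matrix (Idx d) (Idx d) ℝ)

/-- The matrix of the boost `a_t`. -/
def boost (d : ℕ) (t : ℝ) : Matrix (Idx d) (Idx d) ℝ :=
  Matrix.fromBlocks 1 0 0 !![Real.cosh t, Real.sinh t; Real.sinh t, Real.cosh t]

lemma lorentz_eq (d : ℕ) : lorentz d = Matrix.fromBlocks 1 0 0 !![1, 0; 0, -1] := by
  ext i j
  rcases i with i | i <;> rcases j with j | j
  · simp [lorentz, Matrix.diagonal_apply, Matrix.one_apply]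
  · simp [lorentz]
  · simp [lorentz]
  · fin_cases i <;> fin_cases j <;> simp [lorentz]

lemma boost_det (d : ℕ) (t : ℝ) : (boost d t).det = 1 := by
  unfold boost
  rw [Matrix.det_fromBlocks_zero₂₁, Matrix.det_one, one_mul, Matrix.det_fin_two_of]
  nlinarith [Real.cosh_sq t]

lemma boost_add (d : ℕ) (s t : ℝ) : boost d (s + t) = boost d s * boost d t := by
  unfold boost
  rw [Matrix.fromBlocks_multiply]
  congr 1
  · simp
  · simp
  · simp
  · ext i j
    fin_cases i <;> fin_cases j <;> simp [Real.cosh_add, Real.sinh_add] <;> ring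

lemma boost_lorentz (d : ℕ) (t : ℝ) :
    (boost d t).transpose * lorentz d * boost d t = lorentz d := by
  rw [lorentz_eq]
  unfold boost
  rw [Matrix.fromBlocks_transpose, Matrix.fromBlocks_multiply, Matrix.fromBlocks_multiply]
  congr 1
  · simp
  · simp
  · simp
  · ext i j
    fin_cases i <;> fin_cases j <;> simp [Matrix.mul_apply, Fin.sum_univ_two] <;>
      nlinarith [Real.cosh_sq t]

/-- The one-parameter group `t ↦ a_t`, written as an element of `G`. -/
def a (d : ℕ) (t : ℝ) : G d :=
  ⟨⟨boost d t, boost_det d t⟩, boost_lorentz d t, by simpa [boost] using Real.cosh_pos t⟩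

lemma a_add (d : ℕ) (s t : ℝ) : a d (s + t) = a d s * a d t :=
  Subtype.ext (Subtype.ext (boost_add d s t))

lemma a_zero (d : ℕ) : a d 0 = 1 := by
  have h := a_add d 0 0
  rw [add_zero] at h
  exact (left_eq_mul.mp h)

lemma a_neg (d : ℕ) (t : ℝ) : a d (-t) = (a d t)⁻¹ := by
  rw [eq_inv_iff_mul_eq_one, ← a_add, neg_add_cancel, a_zero]

/-- The Cartan subgroup `A = {a_t}`. -/
def A (d : ℕ) : Subgroup (G d) where
  carrier := Set.range (a d)
  one_mem' := ⟨0, a_zero d⟩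
  mul_mem' := by
    rintro _ _ ⟨s, rfl⟩ ⟨t, rfl⟩
    exact ⟨s + t, a_add d s t⟩
  inv_mem' := by
    rintro _ ⟨t, rfl⟩
    exact ⟨-t, a_neg d t⟩

/-- The unstable horospherical subgroup `U = {u : a_{-t} u a_t → e as t → ∞}`. -/
def U (d : ℕ) : Subgroup (G d) where
  carrier := {u | Tendsto (fun t : ℝ => a d (-t) * u * a d t) atTop (𝓝 1)}
  one_mem' := by simp [a_neg]
  mul_mem' := by
    intro u v hu hv
    have h := Tendsto.mul hu hv
    rw [mul_one] at h
    refine h.congr fun t => ?_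
    rw [a_neg]
    group
  inv_mem' := by
    intro u hu
    have h := Tendsto.inv hu
    rw [inv_one] at h
    refine h.congr fun t => ?_
    rw [a_neg]
    group

/-- The maximal compact subgroup `K ≅ SO(d)`: the orthogonal matrices in `G`. -/
def K (d : ℕ) : Subgroup (G d) where
  carrier := {g | mat g ∈ Matrix.orthogonalGroup (Idx d) ℝ}
  one_mem' := one_mem (Matrix.orthogonalGroup (Idx d) ℝ)
  mul_mem' := fun hg hh => (Matrix.orthogonalGroup (Idx d) ℝ).mul_mem hg hh
  inv_mem' := by
    intro g hg
    have h1 : mat g * mat g⁻¹ = 1 := by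
      have : mat (g * g⁻¹) = 1 := by rw [mul_inv_cancel]; rfl
      exact this
    have h2 : star (mat g) * mat g = 1 := (Unitary.mem_iff.mp hg).1
    have h3 : mat g⁻¹ = star (mat g) := (left_inv_eq_right_inv h2 h1).symm
    change mat g⁻¹ ∈ Matrix.orthogonalGroup (Idx d) ℝ
    rw [h3]
    exact Unitary.star_mem hg

/-- `M = Z_K(A)`, the centralizer of `A` in `K`. -/
def M (d : ℕ) : Subgroup (G d) := K d ⊓ Subgroup.centralizer (A d : Set (G d))

/-- The minimal parabolic subgroup `Q = UMA` (the subgroup generated by `U`, `M` and `A`, which is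
the product set because `MA` normalizes `U`). -/
def Q (d : ℕ) : Subgroup (G d) := U d ⊔ M d ⊔ A d

/-- The boundary sphere `S^{d-1} ≅ Q \ G`, with the quotient topology and its Borel structure
(which is the quotient of the Borel structure of `G`). -/
abbrev Bdry (d : ℕ) : Type := Quotient (QuotientGroup.rightRel (Q d))

/-- The projection `π₋ : G → Q \ G`, `g ↦ Qg`. -/
def proj {d : ℕ} (g : G d) : Bdry d := Quotient.mk _ g

/-- The right action of `G` on `Q \ G`: `(Qx) g = Q(xg)`. -/
def act {d : ℕ} (ξ : Bdry d) (g : G d) : Bdry d :=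
  Quotient.map (fun x => x * g) (by
    intro x y h
    have h' := QuotientGroup.rightRel_apply.mp h
    refine QuotientGroup.rightRel_apply.mpr ?_
    simpa [mul_assoc] using h') ξ

/-- `b` is the `A`-parameter in the `KAU`-decomposition `h g_ξ⁻¹ = k a_b u`, where `g_ξ ∈ Kg`
is such that `π₋(g_ξ) = ξ`. -/
def IsBusemann {d : ℕ} (ξ : Bdry d) (g h : G d) (b : ℝ) : Prop :=
  ∃ k₀ ∈ K d, proj (k₀ * g) = ξ ∧ ∃ k ∈ K d, ∃ u ∈ U d, h * (k₀ * g)⁻¹ = k * a d b * u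

/-- The Busemann function `b_ξ(g,h)`; for `d ≥ 2` it is the unique number with `IsBusemann`. -/
def busemann {d : ℕ} (ξ : Bdry d) (g h : G d) : ℝ :=
  Classical.epsilon (IsBusemann ξ g h)

/-- `ν` is `Γ`-conformal with parameter `β`: `d(γ_*ν)/dν (ξ) = exp(-β b_ξ(γ⁻¹, e))` for every
`γ ∈ Γ`, where `γ_*ν` is the image of `ν` under `ξ ↦ ξγ⁻¹`. -/
def IsConformal {d : ℕ} (Γ : Subgroup (G d)) (β : ℝ) (ν : Measure (Bdry d)) : Prop :=
  ∀ γ ∈ Γ, ν.map (fun ξ => act ξ γ⁻¹) =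
    ν.withDensity (fun ξ => ENNReal.ofReal (Real.exp (-β * busemann ξ γ⁻¹ 1)))

/-- `μ` is quasi-invariant under `MA`: `(m a_t)_* μ` has the measure class of `μ`. -/
def IsQuasiInvariantMA {d : ℕ} {Γ : Subgroup (G d)} (μ : Measure (G d ⧸ Γ)) : Prop :=
  ∀ m ∈ M d, ∀ t : ℝ, μ.map (fun x => (m * a d t) • x) ≪ μ ∧
    μ ≪ μ.map (fun x => (m * a d t) • x)

/-- `μ` on `G / Γ` is induced by `μt` on `G` (`μt` is the lift of `μ`): integrating over `G` means
summing over the fibre `gΓ` and integrating the sum over `G / Γ`. -/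
def IsLift {d : ℕ} {Γ : Subgroup (G d)} (μ : Measure (G d ⧸ Γ)) (μt : Measure (G d)) : Prop :=
  ∀ f : G d → ENNReal, Measurable f →
    ∫⁻ g, f g ∂μt =
      ∫⁻ x, ∑' g : (QuotientGroup.mk ⁻¹' {x} : Set (G d)), f (g : G d) ∂μ

/-- A Borel choice of an element of `K` above every boundary point. -/
def IsBorelSection {d : ℕ} (s : Bdry d → G d) : Prop :=
  Measurable s ∧ ∀ ξ, s ξ ∈ K d ∧ proj (s ξ) = ξ

/-- The coordinates `(u, m, a_t, ξ) ↦ u m a_t s(ξ)` on `G` that belong to a section `s`. -/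
def coord {d : ℕ} (s : Bdry d → G d) (p : U d × M d × ℝ × Bdry d) : G d :=
  (p.1 : G d) * (p.2.1 : G d) * a d p.2.2.1 * s p.2.2.2

/-- The measure `e^{βt} dν dm dt du` on `U × M × A × S^{d-1}`, where `A` is parametrized by `t`. -/
def coordMeasure {d : ℕ} (du : Measure (U d)) (dm : Measure (M d)) (β : ℝ)
    (ν : Measure (Bdry d)) : Measure (U d × M d × ℝ × Bdry d) :=
  du.prod (dm.prod
    (((volume : Measure ℝ).withDensity fun t => ENNReal.ofReal (Real.exp (β * t))).prod ν))

end HoroMeasure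

end

/-!
The lift `μ̃` of `μ` to `G` is left `U`-invariant. An element `q` of `MA` normalizes `U`, so `q_*μ`
is again `U`-invariant; as it is absolutely continuous with respect to the ergodic measure `μ`, its
density is a constant. Hence left translation by `MA` only rescales `μ̃`.

Read in the coordinates of a section, left translation by `u` acts on the factor `U` alone, and left
translation by `m a_r` is the product of an automorphism of `U` with translations of `M` and `ℝ`.
Uniqueness of Haar measure therefore splits off `du` and then `dm`: on the compact group `M` the
scaling factors are `1`. On `ℝ × S^{d-1}` the scaling factor under translation by `r` is a character
`e^{-βr}`, which splits off `e^{βt} dt` and leaves the finite measure `ν`.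

Right translation by `γ ∈ Γ` preserves `μ̃` and acts in the coordinates as a skew product over the
action on the boundary whose shift of the `A` coordinate is the Busemann function. Invariance under
it is the conformality of `ν`. A change of section only rotates the `M` coordinate, hence the
independence of the section.
-/

noncomputable section

namespace HoroMeasure

/-! ### Measures on products -/

section Measure

variable {X Y Z : Type*} [MeasurableSpace X] [MeasurableSpace Y] [MeasurableSpace Z]

lemma map_withDensity_comp {ρ : Measure X} {T : X → Y} (hT : Measurable T) {f : Y → ENNReal}
    (hf : Measurable f) : (ρ.withDensity (f ∘ T)).map T = (ρ.map T).withDensity f := by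
  ext E hE
  rw [Measure.map_apply hT hE, withDensity_apply _ (hT hE), withDensity_apply _ hE,
    setLIntegral_map hE hf hT]
  rfl

lemma map_eq_withDensity_of_map_withDensity_eq {ν : Measure X} {T : X → X} (hT : Measurable T)
    {w D : X → ENNReal} (hw : Measurable w) (hD : Measurable D) (hwD : ∀ x, w x * D (T x) = 1)
    (hν : (ν.withDensity w).map T = ν) : ν.map T = ν.withDensity D := by
  have hmul : w * (D ∘ T) = 1 := funext hwD
  calc ν.map T = (ν.withDensity (w * (D ∘ T))).map T := by rw [hmul, withDensity_one]
    _ = ((ν.withDensity w).map T).withDensity D := by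
      rw [withDensity_mul _ hw (hD.comp hT), map_withDensity_comp hT hD]
    _ = ν.withDensity D := by rw [hν]

lemma map_eq_self_of_map_eq_smul {ρ : Measure X} [IsFiniteMeasure ρ] {T : X → X}
    (hT : Measurable T) {c : ENNReal} (h : ρ.map T = c • ρ) : ρ.map T = ρ := by
  rcases eq_or_ne (ρ Set.univ) 0 with h0 | h0
  · rw [Measure.measure_univ_eq_zero.mp h0, Measure.map_zero]
  · have hmass : ρ Set.univ = c * ρ Set.univ := by
      simpa [Measure.map_apply hT MeasurableSet.univ] using congrArg (· Set.univ) h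
    have hc : c = 1 := by
      rwa [eq_comm, ENNReal.mul_eq_right h0 (measure_ne_top ρ _)] at hmass
    rw [h, hc, one_smul]

lemma map_skew_prod {X' : Type*} [MeasurableSpace X'] {h : Measure X} [SFinite h]
    {h' : Measure X'} [SFinite h'] {ρ : Measure Y} [SFinite ρ] {F : X × Y → X'}
    (hF : Measurable F) {w : Y → ENNReal} (hw : Measurable w)
    (hFw : ∀ y, h.map (fun x => F (x, y)) = w y • h') {T : Y → Z} (hT : Measurable T) :
    (h.prod ρ).map (fun p => (F p, T p.2)) = h'.prod ((ρ.withDensity w).map T) := by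
  have hm : Measurable fun p : X × Y => (F p, T p.2) := hF.prodMk (hT.comp measurable_snd)
  refine Measure.ext_of_lintegral _ fun f hf => ?_
  have hfT : Measurable fun y => ∫⁻ x, f (x, T y) ∂h' := hf.lintegral_prod_left'.comp hT
  have hfibre (y : Y) : ∫⁻ x, f (F (x, y), T y) ∂h = w y * ∫⁻ x, f (x, T y) ∂h' := by
    have hfy : Measurable fun x => f (x, T y) := hf.comp measurable_prodMk_right
    have hFy : Measurable fun x => F (x, y) := hF.comp measurable_prodMk_right
    rw [← smul_eq_mul, ← lintegral_smul_measure, ← hFw, lintegral_map hfy hFy]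
  have hfm : Measurable fun p : X × Y => f (F p, T p.2) := hf.comp hm
  rw [lintegral_map hf hm, lintegral_prod_symm _ hfm.aemeasurable,
    lintegral_prod_symm _ hf.aemeasurable, lintegral_map hf.lintegral_prod_left' hT,
    lintegral_withDensity_eq_lintegral_mul _ hw hfT]
  exact lintegral_congr hfibre

lemma map_skew_mul_right {H : Type*} [Group H] [MeasurableSpace H] [MeasurableMul₂ H]
    (h : Measure H) [SFinite h] [h.IsMulRightInvariant] (ρ : Measure Y) [SFinite ρ] {v : Y → H}
    (hv : Measurable v) {T : Y → Z} (hT : Measurable T) :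
    (h.prod ρ).map (fun p => (p.1 * v p.2, T p.2)) = h.prod (ρ.map T) := by
  have hmap := map_skew_prod (ρ := ρ) (w := 1) (measurable_fst.mul (hv.comp measurable_snd))
    measurable_one (fun y => (map_mul_right_eq_self h (v y)).trans (one_smul ENNReal h).symm) hT
  rwa [withDensity_one] at hmap

lemma exists_measurableSet_ne_zero_ne_top (h : Measure X) [SigmaFinite h] [NeZero h] :
    ∃ C, MeasurableSet C ∧ h C ≠ 0 ∧ h C ≠ ⊤ := by
  obtain ⟨C, hC, -, h0, ht⟩ := Measure.exists_subset_measure_lt_top MeasurableSet.univ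
    (Measure.measure_univ_pos.mpr (NeZero.ne h))
  exact ⟨C, hC, h0.ne', ht.ne⟩

lemma prod_left_cancel {h : Measure X} [SigmaFinite h] [NeZero h] {ρ ρ' : Measure Y} [SFinite ρ]
    [SFinite ρ'] (e : h.prod ρ = h.prod ρ') : ρ = ρ' := by
  obtain ⟨C, -, hC0, hCt⟩ := exists_measurableSet_ne_zero_ne_top h
  ext E _
  have hCE : h C * ρ E = h C * ρ' E := by
    simpa only [Measure.prod_prod] using congrArg (· (C ×ˢ E)) e
  exact (ENNReal.mul_right_inj hC0 hCt).mp hCE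

lemma exists_map_eq_smul_of_map_prod_eq_smul {h : Measure X} [SigmaFinite h] [NeZero h]
    {ρ : Measure Y} [SFinite ρ] {S : X → X} (hS : Measurable S) {T : Y → Y} (hT : Measurable T)
    {k c : ENNReal} (hk0 : k ≠ 0) (hkt : k ≠ ⊤) (hhS : h.map S = k • h)
    (hST : (h.prod ρ).map (Prod.map S T) = c • h.prod ρ) : ∃ c' : ENNReal, ρ.map T = c' • ρ := by
  have hcancel : k • ρ.map T = c • ρ := by
    refine prod_left_cancel (h := h) ?_
    rw [Measure.prod_smul_right, Measure.prod_smul_right, ← hST, ← Measure.map_prod_map _ _ hS hT,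
      hhS, Measure.prod_smul_left]
  refine ⟨k⁻¹ * c, ?_⟩
  rw [mul_smul, ← hcancel, smul_smul, ENNReal.inv_mul_cancel hk0 hkt, one_smul]

/-- The slice of a measure on `X × Y` over `E ⊆ Y`, a measure on `X`. -/
def slice (lam : Measure (X × Y)) (E : Set Y) : Measure X :=
  (lam.restrict (Set.univ ×ˢ E)).fst

lemma slice_apply (lam : Measure (X × Y)) (E : Set Y) {B : Set X} (hB : MeasurableSet B) :
    slice lam E B = lam (B ×ˢ E) := by
  rw [slice, Measure.fst_apply hB, Measure.restrict_apply (measurable_fst hB)]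
  congr 1
  ext p
  simp

lemma map_slice_eq_smul {lam : Measure (X × Y)} {T : X → X} (hT : Measurable T) {c : ENNReal}
    (hlam : lam.map (Prod.map T id) = c • lam) {E : Set Y} (hE : MeasurableSet E) :
    (slice lam E).map T = c • slice lam E := by
  ext B hB
  rw [Measure.map_apply hT hB, slice_apply _ _ (hT hB), Measure.smul_apply, slice_apply _ _ hB,
    ← Measure.smul_apply, ← hlam, Measure.map_apply (hT.prodMap measurable_id) (hB.prod hE)]
  rfl

lemma exists_eq_prod_of_slice_eq_smul {h : Measure X} [SigmaFinite h] [NeZero h]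
    {lam : Measure (X × Y)} {S : ℕ → Set Y} (hSm : ∀ n, MeasurableSet (S n)) (hmono : Monotone S)
    (hS : ⋃ n, S n = Set.univ)
    (hslice : ∀ n E, MeasurableSet E → E ⊆ S n → ∃ k : NNReal, slice lam E = k • h) :
    ∃ ν : Measure Y, (∀ n, ν (S n) < ⊤) ∧ lam = h.prod ν := by
  obtain ⟨C, hC, hC0, hCt⟩ := exists_measurableSet_ne_zero_ne_top h
  let ν : Measure Y := (h C)⁻¹ • (lam.restrict (C ×ˢ Set.univ)).snd
  have hν {E : Set Y} (hE : MeasurableSet E) {k : NNReal} (hk : slice lam E = k • h) :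
      ν E = k := by
    have hCE : (lam.restrict (C ×ˢ Set.univ)).snd E = k * h C := by
      rw [Measure.snd_apply hE, Measure.restrict_apply (measurable_snd hE),
        ← smul_eq_mul, ← ENNReal.smul_def, ← Measure.smul_apply, ← hk, slice_apply _ _ hC]
      congr 1
      ext p
      simp [and_comm]
    rw [Measure.smul_apply, hCE, smul_eq_mul, mul_left_comm, ENNReal.inv_mul_cancel hC0 hCt,
      mul_one]
  have hfin (n : ℕ) : ν (S n) < ⊤ := by
    obtain ⟨k, hk⟩ := hslice n _ (hSm n) subset_rfl
    exact hν (hSm n) hk ▸ ENNReal.coe_lt_top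
  have hσ : SigmaFinite ν := ⟨⟨⟨S, fun _ => trivial, hfin, hS⟩⟩⟩
  refine ⟨ν, hfin, (Measure.prod_eq fun B E hB hE => ?_).symm⟩
  have hmonoE : Monotone fun n => E ∩ S n := fun i j hij =>
    Set.inter_subset_inter_right _ (hmono hij)
  have hmonoBE : Monotone fun n => B ×ˢ (E ∩ S n) := fun i j hij =>
    Set.prod_mono le_rfl (hmonoE hij)
  have hunion : E = ⋃ n, E ∩ S n := by rw [← Set.inter_iUnion, hS, Set.inter_univ]
  rw [hunion, Set.prod_iUnion, hmonoBE.measure_iUnion, hmonoE.measure_iUnion, ENNReal.mul_iSup]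
  refine iSup_congr fun n => ?_
  have hEn : MeasurableSet (E ∩ S n) := hE.inter (hSm n)
  obtain ⟨k, hk⟩ := hslice n _ hEn Set.inter_subset_right
  rw [hν hEn hk, ← slice_apply _ _ hB, hk, mul_comm]
  rfl

end Measure

/-! ### Invariant measures on groups -/

section Haar

variable {H Y : Type*} [Group H] [TopologicalSpace H] [IsTopologicalGroup H]
  [MeasurableSpace H] [BorelSpace H] [MeasurableSpace Y]

lemma isMulRightInvariant_of_isFiniteMeasure [LocallyCompactSpace H] [SecondCountableTopology H]
    (h : Measure H) [h.IsHaarMeasure] [IsFiniteMeasure h] : h.IsMulRightInvariant where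
  map_mul_right_eq_self g := map_eq_self_of_map_eq_smul (measurable_mul_const g)
    (c := Measure.haarScalarFactor (h.map (· * g)) h) (Measure.isMulLeftInvariant_eq_smul _ h)

lemma exists_eq_prod_of_map_mul_left_eq_self [LocallyCompactSpace H] [SecondCountableTopology H]
    (h : Measure H) [h.IsHaarMeasure] {lam : Measure (H × Y)} {S : ℕ → Set Y}
    (hSm : ∀ n, MeasurableSet (S n)) (hmono : Monotone S) (hS : ⋃ n, S n = Set.univ)
    (hfin : ∀ C, IsCompact C → ∀ n, lam (C ×ˢ S n) < ⊤)
    (hinv : ∀ g : H, lam.map (Prod.map (g * ·) id) = lam) :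
    ∃ ν : Measure Y, (∀ n, ν (S n) < ⊤) ∧ lam = h.prod ν := by
  refine exists_eq_prod_of_slice_eq_smul hSm hmono hS fun n E hE hES => ?_
  have hli : (slice lam E).IsMulLeftInvariant := ⟨fun g => by
    simpa using map_slice_eq_smul (c := 1) (measurable_const_mul g)
      (by rw [hinv, one_smul]) hE⟩
  have hfc : IsFiniteMeasureOnCompacts (slice lam E) := ⟨fun C hC => by
    refine (measure_mono subset_closure).trans_lt ?_
    rw [slice_apply _ _ isClosed_closure.measurableSet]
    exact (measure_mono (Set.prod_mono le_rfl hES)).trans_lt (hfin _ hC.closure n)⟩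
  exact ⟨_, Measure.isMulLeftInvariant_eq_smul _ h⟩

lemma exists_eq_prod_of_map_mul_left_eq_smul [CompactSpace H] [SecondCountableTopology H]
    (h : Measure H) [h.IsHaarMeasure] {lam : Measure (H × Y)} {S : ℕ → Set Y}
    (hSm : ∀ n, MeasurableSet (S n)) (hmono : Monotone S) (hS : ⋃ n, S n = Set.univ)
    (hfin : ∀ n, lam (Set.univ ×ˢ S n) < ⊤)
    (hquasi : ∀ g : H, ∃ c : ENNReal, lam.map (Prod.map (g * ·) id) = c • lam) :
    ∃ ν : Measure Y, (∀ n, ν (S n) < ⊤) ∧ lam = h.prod ν := by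
  refine exists_eq_prod_of_slice_eq_smul hSm hmono hS fun n E hE hES => ?_
  have hfinite : IsFiniteMeasure (slice lam E) := ⟨by
    rw [slice_apply _ _ MeasurableSet.univ]
    exact (measure_mono (Set.prod_mono le_rfl hES)).trans_lt (hfin n)⟩
  have hli : (slice lam E).IsMulLeftInvariant := ⟨fun g => by
    obtain ⟨c, hc⟩ := hquasi g
    have hg : Measurable (g * ·) := measurable_const_mul g
    exact map_eq_self_of_map_eq_smul hg (map_slice_eq_smul hg hc hE)⟩
  exact ⟨_, Measure.isMulLeftInvariant_eq_smul _ h⟩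

end Haar

/-! ### Exponential measures on the line -/

/-- The density `e^{βt}`. -/
def expDens (β t : ℝ) : ENNReal := ENNReal.ofReal (Real.exp (β * t))

/-- The measure `e^{βt} dt` on the line. -/
def expMeasure (β : ℝ) : Measure ℝ := volume.withDensity (expDens β)

lemma measurable_expDens (β : ℝ) : Measurable (expDens β) := by
  unfold expDens
  fun_prop

lemma expDens_zero (β : ℝ) : expDens β 0 = 1 := by simp [expDens]

lemma expDens_add (β s t : ℝ) : expDens β (s + t) = expDens β s * expDens β t := by
  rw [expDens, expDens, expDens, ← ENNReal.ofReal_mul (Real.exp_pos _).le, ← Real.exp_add, mul_add]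

lemma expDens_mul_expDens_neg (β t : ℝ) : expDens β t * expDens β (-t) = 1 := by
  rw [← expDens_add, add_neg_cancel, expDens_zero]

instance (β : ℝ) : SigmaFinite (expMeasure β) :=
  SigmaFinite.withDensity_ofReal _

instance (β : ℝ) : NeZero (expMeasure β) where
  out h := by
    have hvol : (volume : Measure ℝ) = 0 := by
      refine Measure.absolutelyContinuous_zero_iff.mp ?_
      rw [← h]
      exact withDensity_absolutelyContinuous' (measurable_expDens β).aemeasurable
        (.of_forall fun t => (ENNReal.ofReal_pos.mpr (Real.exp_pos _)).ne')
    exact NeZero.ne (volume : Measure ℝ) hvol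

lemma map_add_right_withDensity_expDens (ρ : Measure ℝ) (β τ : ℝ) :
    (ρ.withDensity (expDens β)).map (· + τ) =
      expDens β (-τ) • (ρ.map (· + τ)).withDensity (expDens β) := by
  have hsplit : expDens β = (expDens β (-τ) • expDens β) ∘ (· + τ) := by
    funext t
    simp only [Function.comp_apply, Pi.smul_apply, smul_eq_mul]
    rw [← expDens_add, neg_add_cancel_comm_assoc]
  conv_lhs => rw [hsplit]
  rw [map_withDensity_comp (measurable_add_const τ) ((measurable_expDens β).const_smul _),
    withDensity_smul _ (measurable_expDens β)]

lemma map_add_right_expMeasure (β τ : ℝ) :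
    (expMeasure β).map (· + τ) = expDens β (-τ) • expMeasure β := by
  rw [expMeasure, map_add_right_withDensity_expDens, map_add_right_eq_self]

lemma map_skew_add_expMeasure {Y Z : Type*} [MeasurableSpace Y] [MeasurableSpace Z] (β : ℝ)
    (ν : Measure Y) [SFinite ν] {τ : Y → ℝ} (hτ : Measurable τ) {T : Y → Z} (hT : Measurable T) :
    ((expMeasure β).prod ν).map (fun p => (p.1 + τ p.2, T p.2)) =
      (expMeasure β).prod ((ν.withDensity fun y => expDens β (-τ y)).map T) :=
  map_skew_prod (measurable_fst.add (hτ.comp measurable_snd)) ((measurable_expDens β).comp hτ.neg)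
    (fun y => map_add_right_expMeasure β (τ y)) hT

lemma exists_eq_smul_expMeasure {β : ℝ} {ρ : Measure ℝ} [IsLocallyFiniteMeasure ρ]
    (hρ : ∀ r, ρ.map (· + r) = expDens β (-r) • ρ) : ∃ k : NNReal, ρ = k • expMeasure β := by
  let ρ' : Measure ℝ := ρ.withDensity (expDens (-β))
  have hlf : IsLocallyFiniteMeasure ρ' :=
    IsLocallyFiniteMeasure.withDensity_ofReal (by fun_prop)
  have hli : ρ'.IsAddLeftInvariant := ⟨fun r => by
    simp only [add_comm r]
    have hone : expDens (-β) (-r) * expDens β (-r) = 1 := by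
      simpa [expDens] using expDens_mul_expDens_neg β r
    rw [map_add_right_withDensity_expDens, hρ, withDensity_smul_measure, smul_smul, hone,
      one_smul]⟩
  obtain ⟨k, hk⟩ : ∃ k : NNReal, ρ' = k • volume := ⟨_, Measure.isAddLeftInvariant_eq_smul _ _⟩
  have htwist : ρ'.withDensity (expDens β) = ρ := by
    have hone : expDens (-β) * expDens β = 1 := funext fun t => by
      simpa [expDens, mul_comm] using expDens_mul_expDens_neg β t
    rw [← withDensity_mul _ (measurable_expDens _) (measurable_expDens _), hone, withDensity_one]
  refine ⟨k, ?_⟩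
  rw [← htwist, hk, ENNReal.smul_def, withDensity_smul_measure, ← ENNReal.smul_def]
  rfl

lemma exists_eq_expDens_of_measurable {χ : ℝ → ENNReal} (hχ : Measurable χ) (hχ0 : χ 0 = 1)
    (hadd : ∀ r r', χ (r + r') = χ r * χ r') : ∃ β, ∀ r, χ r = expDens β r := by
  have hone (r : ℝ) : χ r * χ (-r) = 1 := by rw [← hadd, add_neg_cancel, hχ0]
  have hne (r : ℝ) : χ r ≠ 0 := fun h => by simpa [h] using hone r
  have hnt (r : ℝ) : χ r ≠ ⊤ := fun h => by simpa [h, ENNReal.top_mul (hne _)] using hone r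
  have hpos (r : ℝ) : 0 < (χ r).toReal := ENNReal.toReal_pos (hne r) (hnt r)
  let L : ℝ →+ ℝ := AddMonoidHom.mk' (fun r => Real.log (χ r).toReal) fun r r' => by
    rw [hadd, ENNReal.toReal_mul, Real.log_mul (hpos r).ne' (hpos r').ne']
  have hL : Continuous L :=
    Measure.AddMonoidHom.continuous_of_measurable L hχ.ennreal_toReal.log
  refine ⟨L 1, fun r => ?_⟩
  have hlin : L r = L 1 * r := by simpa [mul_comm] using map_real_smul L hL r 1
  rw [expDens, ← hlin]
  exact (by rw [Real.exp_log (hpos r), ENNReal.ofReal_toReal (hnt r)] :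
    ENNReal.ofReal (Real.exp (Real.log (χ r).toReal)) = χ r).symm

lemma exists_map_eq_expDens_smul {X : Type*} [MeasurableSpace X] {ρ : Measure X} [SigmaFinite ρ]
    [NeZero ρ] {T : ℝ → X → X} (hT : Measurable (Function.uncurry T)) (hT0 : T 0 = id)
    (hTadd : ∀ r r', T (r + r') = T r ∘ T r')
    (hquasi : ∀ r, ∃ c : ENNReal, ρ.map (T r) = c • ρ) :
    ∃ β, ∀ r, ρ.map (T r) = expDens β (-r) • ρ := by
  choose χ hχ using hquasi
  obtain ⟨C, hC, hC0, hCt⟩ := exists_measurableSet_ne_zero_ne_top ρ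
  have hTr (r : ℝ) : Measurable (T r) := hT.of_uncurry_left
  have hχC (r : ℝ) : χ r = ρ (T r ⁻¹' C) / ρ C := by
    rw [← Measure.map_apply (hTr r) hC, hχ, Measure.smul_apply, smul_eq_mul,
      ENNReal.mul_div_cancel_right hC0 hCt]
  have hχm : Measurable χ := by
    rw [funext hχC]
    exact (measurable_measure_prodMk_left (hT hC)).div_const _
  have hχ0 : χ 0 = 1 := by rw [hχC, hT0, Set.preimage_id, ENNReal.div_self hC0 hCt]
  have hmul (r r' : ℝ) : χ (r + r') = χ r * χ r' := by
    have hcomp : χ (r + r') • ρ = (χ r * χ r') • ρ := by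
      rw [← hχ, hTadd, ← Measure.map_map (hTr r) (hTr r'), hχ r', Measure.map_smul, hχ r,
        smul_smul, mul_comm]
    exact (ENNReal.mul_left_inj hC0 hCt).mp (by simpa using congrArg (· C) hcomp)
  obtain ⟨β, hβ⟩ := exists_eq_expDens_of_measurable hχm hχ0 hmul
  exact ⟨-β, fun r => by rw [hχ, hβ, expDens, expDens, neg_mul_neg]⟩

/-- The strip `[-n, n] × Y`. -/
def strip (Y : Type*) (n : ℕ) : Set (ℝ × Y) := Set.Icc (-n : ℝ) n ×ˢ Set.univ

section Strip

variable {Y : Type*}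

lemma measurableSet_strip [MeasurableSpace Y] (n : ℕ) : MeasurableSet (strip Y n) :=
  measurableSet_Icc.prod MeasurableSet.univ

lemma monotone_strip : Monotone (strip Y) := fun _ _ hij =>
  Set.prod_mono (Set.Icc_subset_Icc (neg_le_neg (Nat.cast_le.mpr hij)) (Nat.cast_le.mpr hij)) le_rfl

lemma iUnion_strip : ⋃ n, strip Y n = Set.univ := by
  refine Set.eq_univ_of_forall fun y => Set.mem_iUnion.mpr ?_
  obtain ⟨n, hn⟩ := exists_nat_ge |y.1|
  exact ⟨n, abs_le.mp hn, trivial⟩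

variable [MeasurableSpace Y]

lemma isLocallyFiniteMeasure_slice {κ : Measure (ℝ × Y)} (hfin : ∀ n, κ (strip Y n) < ⊤)
    (E : Set Y) : IsLocallyFiniteMeasure (slice κ E) := by
  refine ⟨fun r => ?_⟩
  obtain ⟨n, hn⟩ := exists_nat_gt |r|
  refine ⟨Set.Icc (-n : ℝ) n, Icc_mem_nhds (abs_lt.mp hn).1 (abs_lt.mp hn).2, ?_⟩
  rw [slice_apply _ _ measurableSet_Icc]
  exact (measure_mono (Set.prod_mono le_rfl (Set.subset_univ E))).trans_lt (hfin n)

lemma exists_eq_expMeasure_prod_of_map_add_right {κ : Measure (ℝ × Y)}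
    (hfin : ∀ n, κ (strip Y n) < ⊤) {β : ℝ}
    (hκ : ∀ r : ℝ, κ.map (Prod.map (· + r) id) = expDens β (-r) • κ) :
    ∃ ν : Measure Y, IsFiniteMeasure ν ∧ κ = (expMeasure β).prod ν := by
  obtain ⟨ν, hν, h⟩ := exists_eq_prod_of_slice_eq_smul (h := expMeasure β) (lam := κ)
    (S := fun _ => Set.univ) (fun _ => MeasurableSet.univ) monotone_const (Set.iUnion_const _)
    fun _ E hE _ =>
      have := isLocallyFiniteMeasure_slice hfin E
      exists_eq_smul_expMeasure fun r => map_slice_eq_smul (measurable_add_const r) (hκ r) hE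
  exact ⟨ν, ⟨hν 0⟩, h⟩

lemma exists_eq_expMeasure_prod {κ : Measure (ℝ × Y)} (hfin : ∀ n, κ (strip Y n) < ⊤)
    (hquasi : ∀ r : ℝ, ∃ c : ENNReal, κ.map (Prod.map (· + r) id) = c • κ) :
    ∃ (β : ℝ) (ν : Measure Y), IsFiniteMeasure ν ∧ κ = (expMeasure β).prod ν := by
  rcases eq_or_ne κ 0 with rfl | h0
  · exact ⟨0, 0, inferInstance, (Measure.prod_zero _).symm⟩
  have hne : NeZero κ := ⟨h0⟩
  have hσ : SigmaFinite κ := ⟨⟨⟨strip Y, fun _ => trivial, hfin, iUnion_strip⟩⟩⟩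
  have hT : Measurable (Function.uncurry fun r : ℝ => Prod.map (· + r) (id : Y → Y)) :=
    (measurable_snd.fst.add measurable_fst).prodMk measurable_snd.snd
  obtain ⟨β, hβ⟩ := exists_map_eq_expDens_smul (ρ := κ) hT
    (funext fun y => Prod.ext (add_zero y.1) rfl)
    (fun r r' => funext fun y => Prod.ext (by simp [add_assoc, add_comm r]) rfl) hquasi
  exact ⟨β, exists_eq_expMeasure_prod_of_map_add_right hfin hβ⟩

lemma exists_eq_prod_expMeasure_prod {H : Type*} [Group H] [TopologicalSpace H]
    [IsTopologicalGroup H] [CompactSpace H] [SecondCountableTopology H] [MeasurableSpace H]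
    [BorelSpace H] (h : Measure H) [h.IsHaarMeasure] {ρ : Measure (H × ℝ × Y)}
    (hfin : ∀ n, ρ (Set.univ ×ˢ strip Y n) < ⊤)
    (hH : ∀ g : H, ∃ c : ENNReal, ρ.map (Prod.map (g * ·) id) = c • ρ)
    (hadd : ∀ r : ℝ, ∃ c : ENNReal, ρ.map (Prod.map id (Prod.map (· + r) id)) = c • ρ) :
    ∃ (β : ℝ) (ν : Measure Y), IsFiniteMeasure ν ∧ ρ = h.prod ((expMeasure β).prod ν) := by
  obtain ⟨κ, hκ, rfl⟩ := exists_eq_prod_of_map_mul_left_eq_smul h measurableSet_strip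
    monotone_strip iUnion_strip hfin hH
  have hσ : SigmaFinite κ := ⟨⟨⟨strip Y, fun _ => trivial, hκ, iUnion_strip⟩⟩⟩
  obtain ⟨β, ν, hν, rfl⟩ := exists_eq_expMeasure_prod hκ fun r => by
    obtain ⟨c, hc⟩ := hadd r
    exact exists_map_eq_smul_of_map_prod_eq_smul measurable_id
      ((measurable_add_const r).prodMap measurable_id) one_ne_zero ENNReal.one_ne_top
      (by rw [Measure.map_id, one_smul]) hc
  exact ⟨β, ν, hν, rfl⟩

end Strip

/-! ### Ergodic actions -/

section Ergodic

variable {N X : Type*} [Group N] [MulAction N X] [MeasurableSpace X] [MeasurableConstSMul N X]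

lemma exists_eq_smul_of_absolutelyContinuous {μ ν : Measure X} [SigmaFinite μ] [SigmaFinite ν]
    [ErgodicSMul N X μ] [SMulInvariantMeasure N X ν] (hν : ν ≪ μ) :
    ∃ c : ENNReal, ν = c • μ := by
  have hinv (g : N) : (fun x => ν.rnDeriv μ (g • x)) =ᵐ[μ] ν.rnDeriv μ := by
    simpa only [(measurePreserving_smul g _).map_eq] using
      (measurableEmbedding_const_smul g).rnDeriv_map ν μ
  obtain ⟨c, hc⟩ : ∃ c, ν.rnDeriv μ =ᵐ[μ] Function.const X c := by
    refine exists_eventuallyEq_const_of_forall_separating MeasurableSet fun B hB => ?_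
    refine eventuallyConst_pred.mp (ErgodicSMul.aeconst_of_forall_preimage_smul_ae_eq (G := N)
      (Measure.measurable_rnDeriv ν μ hB) fun g => (hinv g).mono fun x hx => ?_)
    exact congrArg (· ∈ B) hx
  refine ⟨c, ?_⟩
  rw [← Measure.withDensity_rnDeriv_eq ν μ hν, withDensity_congr_ae hc]
  exact withDensity_const c

lemma exists_map_eq_smul_of_ergodicSMul {μ : Measure X} [SigmaFinite μ] [ErgodicSMul N X μ]
    {T : X ≃ᵐ X} (hT : ∀ n : N, ∃ n' : N, ∀ x, n • T x = T (n' • x)) (hac : μ.map T ≪ μ) :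
    ∃ c : ENNReal, μ.map T = c • μ := by
  have hσ : SigmaFinite (μ.map T) := T.sigmaFinite_map
  have hinv : SMulInvariantMeasure N X (μ.map T) := ⟨fun n E _ => by
    obtain ⟨n', hn'⟩ := hT n
    have hpre : T ⁻¹' ((n • ·) ⁻¹' E) = (n' • ·) ⁻¹' (T ⁻¹' E) := by
      ext x
      simp only [Set.mem_preimage, hn']
    rw [T.map_apply, T.map_apply, hpre, measure_preimage_smul]⟩
  exact exists_eq_smul_of_absolutelyContinuous (N := N) hac

end Ergodic

/-! ### Lifting measures from `H / Γ` to `H` -/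

section Lift

variable {H : Type*} [Group H] {Γ : Subgroup H}

/-- The sum of `f` over the fibre `x` of `H → H / Γ`. -/
def fibreSum (f : H → ENNReal) (x : H ⧸ Γ) : ENNReal :=
  ∑' g : (QuotientGroup.mk ⁻¹' {x} : Set H), f g

lemma fibreSum_mk (f : H → ENNReal) (g : H) : fibreSum f (g : H ⧸ Γ) = ∑' γ : Γ, f (g * γ) := by
  let e : Γ ≃ (QuotientGroup.mk ⁻¹' {(g : H ⧸ Γ)} : Set H) :=
    { toFun := fun γ => ⟨g * γ, QuotientGroup.mk_mul_of_mem g γ.2⟩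
      invFun := fun h => ⟨g⁻¹ * h, QuotientGroup.eq.mp (Eq.symm h.2)⟩
      left_inv := fun γ => Subtype.ext (inv_mul_cancel_left g γ)
      right_inv := fun h => Subtype.ext (mul_inv_cancel_left g h) }
  exact (e.tsum_eq fun h => f h).symm

lemma fibreSum_comp_mul_left (f : H → ENNReal) (q : H) (x : H ⧸ Γ) :
    fibreSum (fun g => f (q * g)) x = fibreSum f (q • x) := by
  induction x using QuotientGroup.induction_on with
  | H g =>
    rw [MulAction.Quotient.smul_coe, smul_eq_mul, fibreSum_mk, fibreSum_mk]
    simp only [mul_assoc]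

lemma fibreSum_comp_mul_right (f : H → ENNReal) {γ : H} (hγ : γ ∈ Γ) (x : H ⧸ Γ) :
    fibreSum (fun g => f (g * γ)) x = fibreSum f x := by
  induction x using QuotientGroup.induction_on with
  | H g =>
    rw [fibreSum_mk, fibreSum_mk, ← (Equiv.mulRight (⟨γ, hγ⟩ : Γ)).tsum_eq fun δ : Γ => f (g * δ)]
    simp only [mul_assoc, Equiv.coe_mulRight, Subgroup.coe_mul]

lemma fibreSum_indicator_one_le {O : Set H} (hO : O.InjOn ((↑) : H → H ⧸ Γ)) (x : H ⧸ Γ) :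
    fibreSum (O.indicator 1) x ≤ (((↑) : H → H ⧸ Γ) '' O).indicator 1 x := by
  by_cases hx : x ∈ ((↑) : H → H ⧸ Γ) '' O
  · obtain ⟨g, hg, rfl⟩ := hx
    rw [Set.indicator_of_mem (Set.mem_image_of_mem _ hg), fibreSum, tsum_eq_single ⟨g, rfl⟩]
    · exact Set.indicator_le_self' (fun _ _ => zero_le_one) g
    · rintro ⟨g', hg'⟩ hne
      exact Set.indicator_of_notMem (fun hg'O => hne (Subtype.ext (hO hg'O hg hg'))) _
  · rw [Set.indicator_of_notMem hx, fibreSum]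
    refine (ENNReal.tsum_eq_zero.mpr fun g => Set.indicator_of_notMem (fun hg => hx ?_) _).le
    exact ⟨g, hg, g.2⟩

variable [TopologicalSpace H] [MeasurableSpace H] [BorelSpace H]

instance : OpensMeasurableSpace (H ⧸ Γ) :=
  ⟨MeasurableSpace.generateFrom_le fun _ hO =>
    (IsOpen.preimage QuotientGroup.continuous_mk hO).measurableSet⟩

variable [IsTopologicalGroup H]

instance : MeasurableConstSMul H (H ⧸ Γ) :=
  ⟨fun q => QuotientGroup.measurable_from_quotient.mpr
    (QuotientGroup.measurable_coe.comp (measurable_const_mul q))⟩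

variable [SecondCountableTopology H] [DiscreteTopology Γ]

lemma measurable_fibreSum {f : H → ENNReal} (hf : Measurable f) :
    Measurable (fibreSum f : H ⧸ Γ → ENNReal) := by
  have : Countable Γ := countable_of_Lindelof_of_discrete
  refine QuotientGroup.measurable_from_quotient.mpr ?_
  have hmk : (fibreSum f : H ⧸ Γ → ENNReal) ∘ ((↑) : H → H ⧸ Γ) = fun g => ∑' γ : Γ, f (g * γ) :=
    funext (fibreSum_mk f)
  rw [hmk]
  exact Measurable.tsum fun γ => hf.comp (measurable_mul_const _)

/-- The measure on `H` induced by a measure on `H / Γ`: the integral over `H / Γ` of the counting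
measures on the fibres of `H → H / Γ`. -/
def liftMeasure (μ : Measure (H ⧸ Γ)) : Measure H :=
  μ.bind fun x => Measure.sum fun g : (QuotientGroup.mk ⁻¹' {x} : Set H) => Measure.dirac (g : H)

variable (μ : Measure (H ⧸ Γ))

lemma lintegral_liftMeasure {f : H → ENNReal} (hf : Measurable f) :
    ∫⁻ g, f g ∂liftMeasure μ = ∫⁻ x, fibreSum f x ∂μ := by
  have hfibre {f : H → ENNReal} (hf : Measurable f) (x : H ⧸ Γ) :
      ∫⁻ g, f g ∂Measure.sum (fun g : (QuotientGroup.mk ⁻¹' {x} : Set H) =>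
        Measure.dirac (g : H)) = fibreSum f x := by
    rw [lintegral_sum_measure]
    exact tsum_congr fun g => lintegral_dirac' _ hf
  rw [liftMeasure, Measure.lintegral_bind _ hf.aemeasurable]
  · exact lintegral_congr (hfibre hf)
  · refine (Measure.measurable_of_measurable_coe _ fun E hE => ?_).aemeasurable
    simp_rw [← lintegral_indicator_one hE, hfibre (measurable_one.indicator hE)]
    exact measurable_fibreSum (measurable_one.indicator hE)

lemma map_mul_right_liftMeasure {γ : H} (hγ : γ ∈ Γ) :
    (liftMeasure μ).map (· * γ) = liftMeasure μ := by
  refine Measure.ext_of_lintegral _ fun f hf => ?_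
  rw [lintegral_map hf (measurable_mul_const γ),
    lintegral_liftMeasure μ (f := fun g => f (g * γ)) (hf.comp (measurable_mul_const γ)),
    lintegral_liftMeasure μ hf]
  exact lintegral_congr fun x => fibreSum_comp_mul_right f hγ x

variable {μ}

lemma map_mul_left_liftMeasure {q : H} {c : ENNReal} (hq : μ.map (q • ·) = c • μ) :
    (liftMeasure μ).map (q * ·) = c • liftMeasure μ := by
  refine Measure.ext_of_lintegral _ fun f hf => ?_
  calc ∫⁻ g, f g ∂(liftMeasure μ).map (q * ·)
      = ∫⁻ g, f (q * g) ∂liftMeasure μ := lintegral_map hf (measurable_const_mul q)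
    _ = ∫⁻ x, fibreSum f (q • x) ∂μ := by
      rw [lintegral_liftMeasure μ (f := fun g => f (q * g)) (hf.comp (measurable_const_mul q))]
      exact lintegral_congr fun x => fibreSum_comp_mul_left f q x
    _ = ∫⁻ g, f g ∂(c • liftMeasure μ) := by
      rw [← lintegral_map (measurable_fibreSum hf) (measurable_const_smul q), hq,
        lintegral_smul_measure, lintegral_smul_measure, lintegral_liftMeasure μ hf]

lemma liftMeasure_le_of_injOn_mk {O : Set H} (hO : IsOpen O) (hinj : O.InjOn ((↑) : H → H ⧸ Γ)) :
    liftMeasure μ O ≤ μ (((↑) : H → H ⧸ Γ) '' O) := by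
  rw [← lintegral_indicator_one hO.measurableSet,
    lintegral_liftMeasure μ (measurable_one.indicator hO.measurableSet)]
  exact (lintegral_mono (fibreSum_indicator_one_le hinj)).trans (lintegral_indicator_one_le _)

instance [IsLocallyFiniteMeasure μ] : IsLocallyFiniteMeasure (liftMeasure μ) := by
  refine ⟨fun g => ?_⟩
  obtain ⟨e, hge, he⟩ := (Γ.isQuotientCoveringMap
    DiscreteTopology.isDiscrete).isCoveringMap.isLocalHomeomorph g
  obtain ⟨W, hgW, hW, hWμ⟩ := μ.exists_isOpen_measure_lt_top (g : H ⧸ Γ)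
  have hO : IsOpen (e.source ∩ QuotientGroup.mk ⁻¹' W) :=
    e.open_source.inter (hW.preimage QuotientGroup.continuous_mk)
  refine ⟨_, hO.mem_nhds ⟨hge, hgW⟩, ?_⟩
  refine ((liftMeasure_le_of_injOn_mk hO ?_).trans (measure_mono ?_)).trans_lt hWμ
  · rw [he]
    exact e.injOn.mono Set.inter_subset_left
  · exact Set.image_subset_iff.mpr Set.inter_subset_right

end Lift

/-! ### `SO⁺(d,1)` as a topological group -/

variable {d : ℕ}

@[elab_as_elim]
lemma idx_cases {p : Idx d → Prop} (space : ∀ i, p (Sum.inl i)) (flow : p (Sum.inr 0))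
    (time : p (Sum.inr 1)) (i : Idx d) : p i := by
  rcases i with i | i
  · exact space i
  · fin_cases i
    · exact flow
    · exact time

lemma mat_mul (g h : G d) : mat (g * h) = mat g * mat h := rfl

lemma mat_one : mat (1 : G d) = 1 := rfl

lemma mat_a (t : ℝ) : mat (a d t) = boost d t := rfl

lemma mat_injective : Function.Injective (mat : G d → Matrix (Idx d) (Idx d) ℝ) :=
  Subtype.val_injective.comp Subtype.val_injective

lemma mat_lorentz (g : G d) : (mat g).transpose * lorentz d * mat g = lorentz d := g.2.1

lemma mat_lorentz_transpose (g : G d) : mat g * lorentz d * (mat g).transpose = lorentz d :=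
  lorentz_flip g.2.1

lemma mat_time_pos (g : G d) : 0 < mat g (Sum.inr 1) (Sum.inr 1) := g.2.2

lemma mat_time_col (g : G d) :
    ∑ i, mat g (Sum.inl i) (Sum.inr 1) ^ 2 + mat g (Sum.inr 0) (Sum.inr 1) ^ 2
      = mat g (Sum.inr 1) (Sum.inr 1) ^ 2 - 1 :=
  time_col g.2.1

lemma mat_mul_mat_inv (g : G d) : mat g * mat g⁻¹ = 1 := by
  rw [← mat_mul, mul_inv_cancel, mat_one]

lemma mat_inv_mul_mat (g : G d) : mat g⁻¹ * mat g = 1 := by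
  rw [← mat_mul, inv_mul_cancel, mat_one]

lemma continuous_mat : Continuous (mat : G d → Matrix (Idx d) (Idx d) ℝ) :=
  continuous_subtype_val.comp continuous_subtype_val

lemma continuous_mat_apply (i j : Idx d) : Continuous fun g : G d => mat g i j :=
  continuous_mat.matrix_elem i j

lemma range_mat : Set.range (mat : G d → Matrix (Idx d) (Idx d) ℝ) =
    {g | g.det = 1 ∧ g.transpose * lorentz d * g = lorentz d ∧
      1 ≤ g (Sum.inr 1) (Sum.inr 1)} := by
  ext g
  constructor
  · rintro ⟨g, rfl⟩
    have hsq : 0 ≤ mat g (Sum.inr 1) (Sum.inr 1) ^ 2 - 1 := by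
      rw [← mat_time_col]
      positivity
    exact ⟨g.1.2, g.2.1, by nlinarith [mat_time_pos g]⟩
  · rintro ⟨hdet, hform, htime⟩
    exact ⟨⟨⟨g, hdet⟩, hform, one_pos.trans_le htime⟩, rfl⟩

lemma isClosedEmbedding_mat : IsClosedEmbedding (mat : G d → Matrix (Idx d) (Idx d) ℝ) := by
  refine ⟨IsEmbedding.subtypeVal.comp IsEmbedding.subtypeVal, ?_⟩
  have hdet : IsClosed {g : Matrix (Idx d) (Idx d) ℝ | g.det = 1} :=
    isClosed_eq continuous_id.matrix_det continuous_const
  have hform :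
      IsClosed {g : Matrix (Idx d) (Idx d) ℝ | g.transpose * lorentz d * g = lorentz d} :=
    isClosed_eq ((continuous_id.matrix_transpose.matrix_mul continuous_const).matrix_mul
      continuous_id) continuous_const
  have htime : IsClosed {g : Matrix (Idx d) (Idx d) ℝ | 1 ≤ g (Sum.inr 1) (Sum.inr 1)} :=
    isClosed_le continuous_const (continuous_id.matrix_elem _ _)
  rw [range_mat]
  exact hdet.inter (hform.inter htime)

instance : T2Space (G d) := isClosedEmbedding_mat.isEmbedding.t2Space

instance : SecondCountableTopology (G d) :=
  haveI : SecondCountableTopology (Matrix (Idx d) (Idx d) ℝ) :=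
    inferInstanceAs (SecondCountableTopology (Idx d → Idx d → ℝ))
  isClosedEmbedding_mat.isEmbedding.secondCountableTopology

instance (H : Subgroup (G d)) : SecondCountableTopology H :=
  inferInstanceAs (SecondCountableTopology (H : Set (G d)))

instance : LocallyCompactSpace (G d) :=
  haveI : LocallyCompactSpace (Matrix (Idx d) (Idx d) ℝ) :=
    inferInstanceAs (LocallyCompactSpace (Idx d → Idx d → ℝ))
  isClosedEmbedding_mat.locallyCompactSpace

lemma continuous_of_mat {X : Type*} [TopologicalSpace X] {f : X → G d}
    (h : ∀ i j, Continuous fun x => mat (f x) i j) : Continuous f :=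
  isClosedEmbedding_mat.isInducing.continuous_iff.mpr (continuous_matrix h)

lemma continuous_a : Continuous (a d) := by
  refine continuous_of_mat fun i j => ?_
  induction i using idx_cases <;> induction j using idx_cases <;>
    simp [mat_a, boost, Real.continuous_cosh, Real.continuous_sinh, continuous_const]

lemma a_comm (s t : ℝ) : a d s * a d t = a d t * a d s := by
  rw [← a_add, ← a_add, add_comm]

/-! ### The light-like covector `e₀ - e₁` -/

/-- The light-like covector with flow component `1` and time component `-1`. Its stabilizer in
`G`, acting on row vectors from the right, is `UM`, and `Q` is the stabilizer of its line. -/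
def lightCov (d : ℕ) : Idx d → ℝ := Sum.elim 0 ![1, -1]

/-- The image of `lightCov d` under the right action of `g` on row vectors. Its line depends on
`Qg` only, and its length determines the height of `g`. -/
def lightRow (g : G d) : Idx d → ℝ := Matrix.vecMul (lightCov d) (mat g)

lemma lightRow_mul (g h : G d) : lightRow (g * h) = Matrix.vecMul (lightRow g) (mat h) := by
  rw [lightRow, lightRow, mat_mul, Matrix.vecMul_vecMul]

lemma lightRow_one : lightRow (1 : G d) = lightCov d := by
  rw [lightRow, mat_one, Matrix.vecMul_one]

lemma lightRow_apply (g : G d) (j : Idx d) :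
    lightRow g j = mat g (Sum.inr 0) j - mat g (Sum.inr 1) j := by
  simp [lightRow, lightCov, Matrix.vecMul, dotProduct, Fintype.sum_sum_type, sub_eq_add_neg]

lemma lightRow_mul_of_eq {g : G d} {c : ℝ} (hg : lightRow g = c • lightCov d) (h : G d) :
    lightRow (g * h) = c • lightRow h := by
  rw [lightRow_mul, hg, Matrix.smul_vecMul, lightRow]

lemma lightRow_inv_of_eq {g : G d} {c : ℝ} (hc : c ≠ 0) (hg : lightRow g = c • lightCov d) :
    lightRow g⁻¹ = c⁻¹ • lightCov d := by
  have h := lightRow_mul_of_eq hg g⁻¹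
  rw [mul_inv_cancel, lightRow_one] at h
  rw [h, inv_smul_smul₀ hc]

lemma continuous_lightRow (j : Idx d) : Continuous fun g : G d => lightRow g j := by
  simp only [lightRow_apply]
  exact (continuous_mat_apply _ _).sub (continuous_mat_apply _ _)

lemma lightRow_a (t : ℝ) : lightRow (a d t) = Real.exp (-t) • lightCov d := by
  funext j
  rw [lightRow_apply, mat_a, ← Real.cosh_sub_sinh]
  induction j using idx_cases <;> simp [boost, lightCov]

lemma lightRow_mul_a_space (g : G d) (t : ℝ) (i : Fin (d - 1)) :
    lightRow (g * a d t) (Sum.inl i) = lightRow g (Sum.inl i) := by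
  simp [lightRow_mul, mat_a, boost, Matrix.vecMul, dotProduct, Fintype.sum_sum_type,
    Matrix.one_apply]

lemma lightRow_mul_a_add (g : G d) (t : ℝ) :
    lightRow (g * a d t) (Sum.inr 0) + lightRow (g * a d t) (Sum.inr 1) =
      Real.exp t * (lightRow g (Sum.inr 0) + lightRow g (Sum.inr 1)) := by
  simp only [lightRow_mul, mat_a, boost, Matrix.vecMul, dotProduct, Fintype.sum_sum_type,
    Fin.sum_univ_two, Matrix.fromBlocks_apply₁₂, Matrix.fromBlocks_apply₂₂, Matrix.zero_apply,
    Matrix.of_apply, Matrix.cons_val', Matrix.cons_val_zero, Matrix.cons_val_one,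
    Matrix.cons_val_fin_one, mul_zero, Finset.sum_const_zero, zero_add, ← Real.cosh_add_sinh]
  ring

lemma vecMul_lorentz_dotProduct_self (v : Idx d → ℝ) :
    Matrix.vecMul v (lorentz d) ⬝ᵥ v =
      ∑ i, v (Sum.inl i) ^ 2 + v (Sum.inr 0) ^ 2 - v (Sum.inr 1) ^ 2 := by
  simp [lorentz, Matrix.vecMul_diagonal, dotProduct, Fintype.sum_sum_type, sq]
  ring

lemma lightRow_null (g : G d) :
    ∑ i, lightRow g (Sum.inl i) ^ 2 + lightRow g (Sum.inr 0) ^ 2 =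
      lightRow g (Sum.inr 1) ^ 2 := by
  have hform : Matrix.vecMul (lightRow g) (lorentz d) ⬝ᵥ lightRow g =
      Matrix.vecMul (lightCov d) (lorentz d) ⬝ᵥ lightCov d := by
    conv_rhs => rw [← mat_lorentz_transpose g, ← Matrix.vecMul_vecMul, ← Matrix.vecMul_vecMul,
      ← Matrix.dotProduct_mulVec, Matrix.mulVec_transpose]
    rfl
  rw [vecMul_lorentz_dotProduct_self, vecMul_lorentz_dotProduct_self] at hform
  simpa [lightCov, sub_eq_zero] using hform

lemma lightRow_time_neg (g : G d) : lightRow g (Sum.inr 1) < 0 := by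
  have hspace : 0 ≤ ∑ i, mat g (Sum.inl i) (Sum.inr 1) ^ 2 := by positivity
  have hsq : mat g (Sum.inr 0) (Sum.inr 1) ^ 2 < mat g (Sum.inr 1) (Sum.inr 1) ^ 2 := by
    linarith [mat_time_col g]
  rw [lightRow_apply, sub_neg]
  exact (abs_lt.mp (abs_lt_of_sq_lt_sq hsq (mat_time_pos g).le)).2

/-- The height of `g`: the parameter `t` of its `UAK`-decomposition `g = u a_t k`. -/
def height (g : G d) : ℝ := -Real.log (-lightRow g (Sum.inr 1))

lemma lightRow_time (g : G d) : lightRow g (Sum.inr 1) = -Real.exp (-height g) := by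
  rw [height, neg_neg, Real.exp_log (neg_pos.mpr (lightRow_time_neg g)), neg_neg]

lemma continuous_height : Continuous (height : G d → ℝ) :=
  ((continuous_lightRow _).neg.log fun g => (neg_pos.mpr (lightRow_time_neg g)).ne').neg

lemma height_of_lightRow_time {g : G d} (hg : lightRow g (Sum.inr 1) = -1) : height g = 0 := by
  simp [height, hg]

lemma height_one : height (1 : G d) = 0 :=
  height_of_lightRow_time (by simp [lightRow_one, lightCov])

lemma eq_exp_neg_height_of_lightRow_eq {g : G d} {c : ℝ} (hg : lightRow g = c • lightCov d) :
    c = Real.exp (-height g) := by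
  have htime := congrFun hg (Sum.inr 1)
  rw [lightRow_time] at htime
  simpa [lightCov] using htime.symm

lemma height_mul_of_eq {g : G d} {c : ℝ} (hg : lightRow g = c • lightCov d) (h : G d) :
    height (g * h) = height g + height h := by
  have htime : lightRow (g * h) (Sum.inr 1) = c * lightRow h (Sum.inr 1) :=
    congrFun (lightRow_mul_of_eq hg h) _
  rw [eq_exp_neg_height_of_lightRow_eq hg, lightRow_time, lightRow_time, mul_neg, ← Real.exp_add,
    neg_inj, Real.exp_eq_exp] at htime
  linarith

lemma lightRow_eq_exp_smul {g : G d} (hspace : ∀ i, lightRow g (Sum.inl i) = 0)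
    (hadd : lightRow g (Sum.inr 0) + lightRow g (Sum.inr 1) = 0) :
    lightRow g = Real.exp (-height g) • lightCov d := by
  funext j
  induction j using idx_cases with
  | space i => simp [hspace, lightCov]
  | flow => simp [lightCov, eq_neg_of_add_eq_zero_left hadd, lightRow_time]
  | time => simp [lightCov, lightRow_time]

/-! ### The maximal compact subgroup -/

lemma mem_K_iff_transpose_mul {g : G d} : g ∈ K d ↔ (mat g).transpose * mat g = 1 :=
  Matrix.mem_orthogonalGroup_iff' _ _

lemma mem_K_iff_commute_lorentz {g : G d} : g ∈ K d ↔ mat g * lorentz d = lorentz d * mat g := by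
  rw [mem_K_iff_transpose_mul]
  constructor <;> intro hg
  · calc mat g * lorentz d
        = (mat g * (mat g).transpose) * lorentz d * mat g := by
          conv_lhs => rw [← mat_lorentz g]
          simp only [Matrix.mul_assoc]
      _ = lorentz d * mat g := by rw [mul_eq_one_comm.mp hg, Matrix.one_mul]
  · calc (mat g).transpose * mat g
        = (mat g).transpose * (mat g * lorentz d) * lorentz d := by
          simp only [Matrix.mul_assoc, lorentz_mul_self, Matrix.mul_one]
      _ = 1 := by rw [hg, ← Matrix.mul_assoc, mat_lorentz, lorentz_mul_self]

lemma mat_inv_of_mem_K {g : G d} (hg : g ∈ K d) : mat g⁻¹ = (mat g).transpose :=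
  (left_inv_eq_right_inv (mem_K_iff_transpose_mul.mp hg) (mat_mul_mat_inv g)).symm

lemma time_col_of_mem_K {g : G d} (hg : g ∈ K d) (i : Idx d) :
    mat g i (Sum.inr 1) = (1 : Matrix (Idx d) (Idx d) ℝ) i (Sum.inr 1) := by
  have hcomm (i : Idx d) : (mat g * lorentz d) i (Sum.inr 1) = (lorentz d * mat g) i (Sum.inr 1) :=
    congrFun (congrFun (mem_K_iff_commute_lorentz.mp hg) i) _
  simp only [lorentz, Matrix.mul_diagonal, Matrix.diagonal_mul, Sum.elim_inr, Matrix.cons_val_one,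
    Matrix.cons_val_fin_one, mul_neg, mul_one] at hcomm
  have hspace (i : Fin (d - 1)) : mat g (Sum.inl i) (Sum.inr 1) = 0 := by
    have := hcomm (Sum.inl i)
    simp only [Sum.elim_inl, one_mul] at this
    linarith
  have hflow : mat g (Sum.inr 0) (Sum.inr 1) = 0 := by
    have := hcomm (Sum.inr 0)
    simp only [Sum.elim_inr, Matrix.cons_val_zero, one_mul] at this
    linarith
  have htime := mat_time_col g
  simp only [hspace, hflow, ne_eq, OfNat.ofNat_ne_zero, not_false_eq_true, zero_pow,
    Finset.sum_const_zero, add_zero] at htime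
  induction i using idx_cases with
  | space i => simpa using hspace i
  | flow => simpa using hflow
  | time => rw [Matrix.one_apply_eq]; nlinarith [mat_time_pos g]

lemma time_row_of_mem_K {g : G d} (hg : g ∈ K d) (j : Idx d) :
    mat g (Sum.inr 1) j = (1 : Matrix (Idx d) (Idx d) ℝ) (Sum.inr 1) j := by
  have h := time_col_of_mem_K ((K d).inv_mem hg) j
  rwa [mat_inv_of_mem_K hg, Matrix.transpose_apply, ← Matrix.transpose_one,
    Matrix.transpose_apply] at h

lemma mem_K_of_time_col {g : G d}
    (hg : ∀ i, mat g i (Sum.inr 1) = (1 : Matrix (Idx d) (Idx d) ℝ) i (Sum.inr 1)) : g ∈ K d := by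
  have hrow (j : Idx d) :
      mat g (Sum.inr 1) j = (1 : Matrix (Idx d) (Idx d) ℝ) (Sum.inr 1) j := by
    have hj : ((mat g).transpose * (lorentz d * mat g)) (Sum.inr 1) j =
        lorentz d (Sum.inr 1) j := by
      rw [← Matrix.mul_assoc, mat_lorentz]
    rw [Matrix.mul_apply] at hj
    simp only [Matrix.transpose_apply, hg, Matrix.one_apply, ite_mul, one_mul, zero_mul,
      Finset.sum_ite_eq', Finset.mem_univ, if_true] at hj
    simp only [lorentz, Matrix.diagonal_mul, Matrix.diagonal_apply, Sum.elim_inr,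
      Matrix.cons_val_one, Matrix.cons_val_fin_one] at hj
    rw [Matrix.one_apply]
    split_ifs at hj ⊢ <;> linarith
  rw [mem_K_iff_commute_lorentz]
  ext i j
  rw [lorentz, Matrix.mul_diagonal, Matrix.diagonal_mul]
  induction i using idx_cases <;> induction j using idx_cases <;> simp [hg, hrow]

lemma inv_mul_mem_K {g h : G d} (e : ∀ i, mat h i (Sum.inr 1) = mat g i (Sum.inr 1)) :
    g⁻¹ * h ∈ K d := by
  refine mem_K_of_time_col fun i => ?_
  rw [mat_mul, Matrix.mul_apply]
  simp only [e]
  rw [← Matrix.mul_apply, mat_inv_mul_mat]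

lemma time_col_mul_of_mem_K (g : G d) {k : G d} (hk : k ∈ K d) (i : Idx d) :
    mat (g * k) i (Sum.inr 1) = mat g i (Sum.inr 1) := by
  rw [mat_mul, Matrix.mul_apply]
  simp only [time_col_of_mem_K hk]
  rw [← Matrix.mul_apply, mul_one]

lemma lightRow_time_of_mem_K {g : G d} (hg : g ∈ K d) : lightRow g (Sum.inr 1) = -1 := by
  rw [lightRow_apply, time_col_of_mem_K hg, time_col_of_mem_K hg]
  simp

lemma height_of_mem_K {g : G d} (hg : g ∈ K d) : height g = 0 :=
  height_of_lightRow_time (lightRow_time_of_mem_K hg)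

lemma isCompact_K : IsCompact (K d : Set (G d)) := by
  have hK : (K d : Set (G d)) = mat ⁻¹' {g | g.transpose * g = 1} :=
    Set.ext fun _ => mem_K_iff_transpose_mul
  rw [hK]
  refine isClosedEmbedding_mat.isCompact_preimage (IsCompact.of_isClosed_subset
    (isCompact_univ_pi fun _ : Idx d => isCompact_univ_pi fun _ : Idx d =>
      (isCompact_Icc : IsCompact (Set.Icc (-1 : ℝ) 1))) ?_ fun g hg i _ j _ => ?_)
  · exact isClosed_eq (continuous_id.matrix_transpose.matrix_mul continuous_id) continuous_const
  · have hcol : ∑ k, g k j ^ 2 = 1 := by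
      simpa [Matrix.mul_apply, ← sq] using congrFun (congrFun hg j) j
    have hij : g i j ^ 2 ≤ 1 := hcol ▸
      Finset.single_le_sum (f := fun k => g k j ^ 2) (fun _ _ => sq_nonneg _) (Finset.mem_univ i)
    exact abs_le.mp ((sq_le_one_iff_abs_le_one _).mp hij)

/-! ### Horospherical translations and the `UAK`-decomposition -/

/-- The matrix of the horospherical translation by `x`: the unipotent matrix which fixes the
covector `lightCov d` and moves the origin of the hyperboloid to a point with space-like
coordinates `x`. -/
def horMat (x : Fin (d - 1) → ℝ) : Matrix (Idx d) (Idx d) ℝ :=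
  Matrix.fromBlocks 1 (Matrix.of fun i => ![-x i, x i]) (Matrix.of fun _ j => x j)
    !![1 - (∑ i, x i ^ 2) / 2, (∑ i, x i ^ 2) / 2; -((∑ i, x i ^ 2) / 2), 1 + (∑ i, x i ^ 2) / 2]

lemma horMat_det (x : Fin (d - 1) → ℝ) : (horMat x).det = 1 := by
  rw [horMat, Matrix.det_fromBlocks_one₁₁, Matrix.det_fin_two]
  simp only [Matrix.sub_apply, Matrix.mul_apply, Matrix.of_apply, Matrix.cons_val_zero,
    Matrix.cons_val_one, mul_neg, Finset.sum_neg_distrib, ← sq, Matrix.cons_val',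
    Matrix.cons_val_fin_one]
  ring

lemma horMat_add (x y : Fin (d - 1) → ℝ) : horMat (x + y) = horMat x * horMat y := by
  have hq : ∑ i, (x + y) i ^ 2 = ∑ i, x i ^ 2 + ∑ i, y i ^ 2 + 2 * ∑ i, x i * y i := by
    rw [Finset.mul_sum, ← Finset.sum_add_distrib, ← Finset.sum_add_distrib]
    exact Finset.sum_congr rfl fun i _ => by simp only [Pi.add_apply]; ring
  unfold horMat
  rw [hq, Matrix.fromBlocks_multiply]
  congr 1
  · ext i j
    simp [Matrix.mul_apply, Fin.sum_univ_two]
  · ext i j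
    fin_cases j <;> simp [Matrix.mul_apply, Fin.sum_univ_two] <;> ring
  · ext i j
    fin_cases i <;> simp [Matrix.vecHead, Matrix.vecTail] <;> ring
  · ext i j
    fin_cases i <;> fin_cases j <;> simp [Matrix.mul_apply] <;> ring

lemma horMat_lorentz (x : Fin (d - 1) → ℝ) :
    (horMat x).transpose * lorentz d * horMat x = lorentz d := by
  rw [lorentz_eq]
  unfold horMat
  rw [Matrix.fromBlocks_transpose, Matrix.fromBlocks_multiply, Matrix.fromBlocks_multiply]
  congr 1
  · ext i j
    simp [Matrix.mul_apply, Fin.sum_univ_two]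
  · ext i j
    fin_cases j <;> simp [Matrix.mul_apply, Fin.sum_univ_two] <;> ring
  · ext i j
    fin_cases i <;> simp [Matrix.mul_apply, Fin.sum_univ_two] <;> ring
  · ext i j
    fin_cases i <;> fin_cases j <;>
      simp [Matrix.mul_apply, Fin.sum_univ_two, ← sq] <;> ring

/-- The horospherical translation by `x`, as an element of `G`. These elements make up `U`. -/
def hor (x : Fin (d - 1) → ℝ) : G d :=
  ⟨⟨horMat x, horMat_det x⟩, horMat_lorentz x, by
    have : 0 ≤ ∑ i, x i ^ 2 := by positivity
    simp only [horMat, Matrix.fromBlocks_apply₂₂, Matrix.of_apply, Matrix.cons_val_one,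
      Matrix.cons_val_fin_one, Matrix.cons_val']
    linarith⟩

lemma mat_hor (x : Fin (d - 1) → ℝ) : mat (hor x) = horMat x := rfl

lemma hor_add (x y : Fin (d - 1) → ℝ) : hor (x + y) = hor x * hor y :=
  mat_injective (horMat_add x y)

lemma hor_zero : hor (0 : Fin (d - 1) → ℝ) = 1 := by
  have h := hor_add (0 : Fin (d - 1) → ℝ) 0
  rw [add_zero] at h
  exact left_eq_mul.mp h

lemma continuous_hor : Continuous (hor : (Fin (d - 1) → ℝ) → G d) := by
  refine continuous_of_mat fun i j => ?_
  induction i using idx_cases <;> induction j using idx_cases <;>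
    simp only [mat_hor, horMat, Matrix.fromBlocks_apply₁₁, Matrix.fromBlocks_apply₁₂,
      Matrix.fromBlocks_apply₂₁, Matrix.fromBlocks_apply₂₂, Matrix.of_apply, Matrix.cons_val',
      Matrix.cons_val_zero, Matrix.cons_val_one, Matrix.cons_val_fin_one] <;>
    fun_prop

lemma lightRow_hor (x : Fin (d - 1) → ℝ) : lightRow (hor x) = lightCov d := by
  funext j
  rw [lightRow_apply, mat_hor]
  induction j using idx_cases <;> simp [horMat, lightCov]

lemma lightRow_hor_mul_a (x : Fin (d - 1) → ℝ) (t : ℝ) :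
    lightRow (hor x * a d t) = Real.exp (-t) • lightCov d := by
  rw [lightRow_mul, lightRow_hor]
  exact lightRow_a t

lemma height_hor_mul_a_mul (x : Fin (d - 1) → ℝ) (t : ℝ) (g : G d) :
    height (hor x * a d t * g) = t + height g := by
  have hrow := lightRow_hor_mul_a x t
  have ht := neg_inj.mp (Real.exp_injective (eq_exp_neg_height_of_lightRow_eq hrow))
  rw [height_mul_of_eq hrow, ← ht]

lemma time_col_hor_mul_a (x : Fin (d - 1) → ℝ) (t : ℝ) (i : Fin (d - 1)) :
    mat (hor x * a d t) (Sum.inl i) (Sum.inr 1) = x i * Real.exp (-t) := by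
  rw [← Real.cosh_sub_sinh, mat_mul, mat_hor, mat_a, horMat, boost, Matrix.fromBlocks_multiply,
    Matrix.fromBlocks_apply₁₂]
  simp [Matrix.mul_apply, -Real.cosh_sub_sinh]
  ring

/-- The `U`-part of the `UAK`-decomposition of `g`, as a vector of `ℝ^(d-1)`. -/
def horCoord (g : G d) : Fin (d - 1) → ℝ :=
  fun i => mat g (Sum.inl i) (Sum.inr 1) * Real.exp (height g)

lemma continuous_horCoord : Continuous (horCoord : G d → Fin (d - 1) → ℝ) :=
  continuous_pi fun _ => (continuous_mat_apply _ _).mul (Real.continuous_exp.comp continuous_height)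

lemma horCoord_hor_mul_a_mul (x : Fin (d - 1) → ℝ) (t : ℝ) {k : G d} (hk : k ∈ K d) :
    horCoord (hor x * a d t * k) = x := by
  funext i
  rw [horCoord, height_hor_mul_a_mul, height_of_mem_K hk, add_zero, time_col_mul_of_mem_K _ hk,
    time_col_hor_mul_a, mul_assoc, ← Real.exp_add, neg_add_cancel, Real.exp_zero, mul_one]

lemma horCoord_hor (x : Fin (d - 1) → ℝ) : horCoord (hor x) = x := by
  simpa [a_zero] using horCoord_hor_mul_a_mul x 0 (one_mem (K d))

lemma time_col_ext {g h : G d}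
    (hspace : ∀ i, mat g (Sum.inl i) (Sum.inr 1) = mat h (Sum.inl i) (Sum.inr 1))
    (hheight : height g = height h) (i : Idx d) : mat g i (Sum.inr 1) = mat h i (Sum.inr 1) := by
  have hsub : mat g (Sum.inr 0) (Sum.inr 1) - mat g (Sum.inr 1) (Sum.inr 1) =
      mat h (Sum.inr 0) (Sum.inr 1) - mat h (Sum.inr 1) (Sum.inr 1) := by
    rw [← lightRow_apply, ← lightRow_apply, lightRow_time, lightRow_time, hheight]
  have hadd : mat g (Sum.inr 0) (Sum.inr 1) + mat g (Sum.inr 1) (Sum.inr 1) =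
      mat h (Sum.inr 0) (Sum.inr 1) + mat h (Sum.inr 1) (Sum.inr 1) := by
    have hneg := lightRow_time_neg h
    have hg := mat_time_col g
    simp only [hspace] at hg
    rw [lightRow_apply] at hneg
    apply mul_left_cancel₀ hneg.ne
    linear_combination hg - mat_time_col h - hsub *
      (mat g (Sum.inr 0) (Sum.inr 1) + mat g (Sum.inr 1) (Sum.inr 1))
  induction i using idx_cases with
  | space i => exact hspace i
  | flow => linarith
  | time => linarith

/-- The `K`-part of the `UAK`-decomposition of `g`. -/
def kPart (g : G d) : G d := (hor (horCoord g) * a d (height g))⁻¹ * g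

lemma hor_mul_a_mul_kPart (g : G d) : hor (horCoord g) * a d (height g) * kPart g = g := by
  rw [kPart, mul_inv_cancel_left]

lemma kPart_mem_K (g : G d) : kPart g ∈ K d := by
  refine inv_mul_mem_K (time_col_ext (fun i => ?_) ?_)
  · rw [time_col_hor_mul_a, horCoord, mul_assoc, ← Real.exp_add, add_neg_cancel, Real.exp_zero,
      mul_one]
  · simpa [height_one] using (height_hor_mul_a_mul (horCoord g) (height g) 1).symm

lemma continuous_kPart : Continuous (kPart : G d → G d) :=
  ((continuous_hor.comp continuous_horCoord).mul
    (continuous_a.comp continuous_height)).inv.mul continuous_id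

/-! ### The subgroups `U`, `M` and `Q` -/

/-- The stabilizer of the line of `lightCov d`, which turns out to be `Q`. -/
def lightStabilizer (d : ℕ) : Subgroup (G d) where
  carrier := {g | ∃ c : ℝ, lightRow g = c • lightCov d}
  one_mem' := ⟨1, by rw [lightRow_one, one_smul]⟩
  mul_mem' := by
    rintro g h ⟨c, hg⟩ ⟨e, hh⟩
    exact ⟨c * e, by rw [lightRow_mul_of_eq hg, hh, smul_smul]⟩
  inv_mem' := by
    rintro g ⟨c, hg⟩
    have hc : c ≠ 0 := eq_exp_neg_height_of_lightRow_eq hg ▸ (Real.exp_pos _).ne'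
    exact ⟨c⁻¹, lightRow_inv_of_eq hc hg⟩

lemma lightRow_of_mem_lightStabilizer {g : G d} (hg : g ∈ lightStabilizer d) :
    lightRow g = Real.exp (-height g) • lightCov d := by
  obtain ⟨c, hc⟩ := hg
  rw [hc, ← eq_exp_neg_height_of_lightRow_eq hc]

lemma mem_lightStabilizer_of_eq_zero {g : G d} (hspace : ∀ i, lightRow g (Sum.inl i) = 0)
    (hadd : lightRow g (Sum.inr 0) + lightRow g (Sum.inr 1) = 0) : g ∈ lightStabilizer d :=
  ⟨_, lightRow_eq_exp_smul hspace hadd⟩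

lemma mem_centralizer_A_iff {q : G d} :
    q ∈ Subgroup.centralizer (A d : Set (G d)) ↔ ∀ t, a d t * q = q * a d t :=
  Subgroup.mem_centralizer_iff.trans Set.forall_mem_range

lemma a_mem_centralizer_A (t : ℝ) : a d t ∈ Subgroup.centralizer (A d : Set (G d)) :=
  mem_centralizer_A_iff.mpr fun r => a_comm r t

lemma M_le_K : M d ≤ K d := inf_le_left

lemma M_le_centralizer_A : M d ≤ Subgroup.centralizer (A d : Set (G d)) := inf_le_right

lemma centralizer_A_le_lightStabilizer :
    Subgroup.centralizer (A d : Set (G d)) ≤ lightStabilizer d := by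
  intro q hq
  have hexp : Real.exp (-1) < 1 := by simp
  have hrow : lightRow (q * a d 1) = Real.exp (-1) • lightRow q := by
    rw [← mem_centralizer_A_iff.mp hq, lightRow_mul_of_eq (lightRow_a 1)]
  refine mem_lightStabilizer_of_eq_zero (fun i => ?_) ?_
  · have hi := congrFun hrow (Sum.inl i)
    rw [lightRow_mul_a_space, Pi.smul_apply, smul_eq_mul] at hi
    by_contra h0
    exact hexp.ne (mul_right_cancel₀ h0 (hi.symm.trans (one_mul _).symm))
  · have hadd := lightRow_mul_a_add q 1
    rw [hrow, Pi.smul_apply, Pi.smul_apply, smul_eq_mul, smul_eq_mul, ← mul_add] at hadd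
    by_contra h0
    exact (hexp.trans (Real.one_lt_exp_iff.mpr one_pos)).ne (mul_right_cancel₀ h0 hadd)

lemma lightRow_of_mem_M {m : G d} (hm : m ∈ M d) : lightRow m = lightCov d := by
  rw [lightRow_of_mem_lightStabilizer (centralizer_A_le_lightStabilizer (M_le_centralizer_A hm)),
    height_of_mem_K (M_le_K hm), neg_zero, Real.exp_zero, one_smul]

lemma row_eq_one_of_lightRow {k : G d} (hk : k ∈ K d) (h : lightRow k = lightCov d) (j : Idx d)
    (i : Fin 2) : mat k (Sum.inr i) j = (1 : Matrix (Idx d) (Idx d) ℝ) (Sum.inr i) j := by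
  have htime := time_row_of_mem_K hk j
  have hflow := congrFun h j
  rw [lightRow_apply, htime, sub_eq_iff_eq_add] at hflow
  revert i
  refine Fin.forall_fin_two.mpr ⟨hflow.trans ?_, htime⟩
  induction j using idx_cases <;> simp [lightCov]

lemma mem_M_of_lightRow {k : G d} (hk : k ∈ K d) (h : lightRow k = lightCov d) : k ∈ M d := by
  have hrow := row_eq_one_of_lightRow hk h
  have hcol (j : Idx d) (i : Fin 2) :
      mat k j (Sum.inr i) = (1 : Matrix (Idx d) (Idx d) ℝ) (Sum.inr i) j := by
    have hinv : lightRow k⁻¹ = lightCov d := by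
      simpa using lightRow_inv_of_eq one_ne_zero (h.trans (one_smul ℝ _).symm)
    simpa only [mat_inv_of_mem_K hk, Matrix.transpose_apply] using
      row_eq_one_of_lightRow ((K d).inv_mem hk) hinv j i
  have hblock : mat k = Matrix.fromBlocks (mat k).toBlocks₁₁ 0 0 1 := by
    ext i j
    rcases i with i | i <;> rcases j with j | j
    · rfl
    · simp [hcol]
    · simp [hrow]
    · simp [hrow, Matrix.one_apply]
  refine ⟨hk, mem_centralizer_A_iff.mpr fun t => mat_injective ?_⟩
  rw [mat_mul, mat_mul, mat_a, hblock, boost, Matrix.fromBlocks_multiply,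
    Matrix.fromBlocks_multiply]
  simp

lemma kPart_mem_M {g : G d} (hg : g ∈ lightStabilizer d) : kPart g ∈ M d := by
  refine mem_M_of_lightRow (kPart_mem_K g) ?_
  have hk : kPart g ∈ lightStabilizer d :=
    mul_mem (inv_mem ⟨_, lightRow_hor_mul_a (horCoord g) (height g)⟩) hg
  rw [lightRow_of_mem_lightStabilizer hk, height_of_mem_K (kPart_mem_K g), neg_zero,
    Real.exp_zero, one_smul]

lemma a_mul_hor_mul_a_neg (t : ℝ) (x : Fin (d - 1) → ℝ) :
    a d t * hor x * a d (-t) = hor (Real.exp t • x) := by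
  have hsum : ∑ i, (Real.exp t • x) i ^ 2 = Real.exp t ^ 2 * ∑ i, x i ^ 2 := by
    simp [mul_pow, Finset.mul_sum]
  apply mat_injective
  rw [mat_mul, mat_mul, mat_a, mat_a, mat_hor, mat_hor, horMat, horMat, boost, boost,
    Matrix.fromBlocks_multiply, Matrix.fromBlocks_multiply, hsum, ← Real.cosh_add_sinh]
  congr 1
  · simp
  · ext i j
    fin_cases j <;>
      simp [Matrix.mul_apply, Fin.sum_univ_two, -Real.cosh_add_sinh, -Real.sinh_add_cosh] <;> ring
  · ext i j
    fin_cases i <;>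
      simp [Matrix.vecHead, Matrix.vecTail, -Real.cosh_add_sinh, -Real.sinh_add_cosh] <;> ring
  · ext i j
    fin_cases i <;> fin_cases j <;> simp [-Real.cosh_add_sinh] <;> ring_nf <;>
      rw [Real.cosh_sq t] <;> ring

lemma hor_mem_U (x : Fin (d - 1) → ℝ) : hor x ∈ U d := by
  have hconj (t : ℝ) : hor (Real.exp (-t) • x) = a d (-t) * hor x * a d t := by
    rw [← a_mul_hor_mul_a_neg, neg_neg]
  have hlim : Tendsto (fun t : ℝ => hor (Real.exp (-t) • x)) atTop (𝓝 (hor ((0 : ℝ) • x))) :=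
    (continuous_hor.tendsto _).comp (Real.tendsto_exp_neg_atTop_nhds_zero.smul_const x)
  rw [zero_smul, hor_zero] at hlim
  exact hlim.congr hconj

lemma tendsto_zero_of_tendsto_exp_mul {f : ℝ → ℝ}
    (hf : Tendsto (fun t => Real.exp t * f t) atTop (𝓝 0)) : Tendsto f atTop (𝓝 0) := by
  have h := Real.tendsto_exp_neg_atTop_nhds_zero.mul hf
  rw [mul_zero] at h
  refine h.congr fun t => ?_
  rw [← mul_assoc, ← Real.exp_add, neg_add_cancel, Real.exp_zero, one_mul]

lemma U_le_lightStabilizer : U d ≤ lightStabilizer d := by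
  intro u hu
  have hrow (t : ℝ) : lightRow (a d (-t) * u * a d t) = Real.exp t • lightRow (u * a d t) := by
    rw [mul_assoc, lightRow_mul_of_eq (lightRow_a (-t)), neg_neg]
  have hlim (j : Idx d) : Tendsto (fun t : ℝ => Real.exp t * lightRow (u * a d t) j) atTop
      (𝓝 (lightCov d j)) := by
    have h := ((continuous_lightRow j).tendsto 1).comp
      (show Tendsto (fun t : ℝ => a d (-t) * u * a d t) atTop (𝓝 1) from hu)
    rw [lightRow_one] at h
    exact h.congr fun t => congrFun (hrow t) j
  refine mem_lightStabilizer_of_eq_zero (fun i => ?_) ?_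
  · have h := tendsto_zero_of_tendsto_exp_mul (hlim (Sum.inl i))
    simp only [lightRow_mul_a_space] at h
    exact tendsto_nhds_unique tendsto_const_nhds h
  · have h := (hlim (Sum.inr 0)).add (hlim (Sum.inr 1))
    simp only [← mul_add, lightRow_mul_a_add, lightCov, Sum.elim_inr, Matrix.cons_val_zero,
      Matrix.cons_val_one, Matrix.cons_val_fin_one, add_neg_cancel] at h
    exact tendsto_nhds_unique tendsto_const_nhds
      (tendsto_zero_of_tendsto_exp_mul (tendsto_zero_of_tendsto_exp_mul h))

lemma eq_one_of_mem_U_of_mem_centralizer_A {u : G d} (hu : u ∈ U d)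
    (hA : u ∈ Subgroup.centralizer (A d : Set (G d))) : u = 1 := by
  have hconst (t : ℝ) : u = a d (-t) * u * a d t := by
    rw [mem_centralizer_A_iff.mp hA, mul_assoc, ← a_add, neg_add_cancel, a_zero, mul_one]
  exact tendsto_nhds_unique (tendsto_const_nhds.congr hconst) hu

lemma hor_horCoord_of_mem_U {u : G d} (hu : u ∈ U d) : hor (horCoord u) = u := by
  have hu' := hor_mul_a_mul_kPart u
  rw [mul_assoc, ← eq_inv_mul_iff_mul_eq] at hu'
  have hone : a d (height u) * kPart u = 1 := by
    refine eq_one_of_mem_U_of_mem_centralizer_A ?_ (mul_mem (a_mem_centralizer_A _)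
      (M_le_centralizer_A (kPart_mem_M (U_le_lightStabilizer hu))))
    rw [hu']
    exact mul_mem (inv_mem (hor_mem_U _)) hu
  rwa [hone, eq_comm, inv_mul_eq_one] at hu'

lemma lightRow_of_mem_U {u : G d} (hu : u ∈ U d) : lightRow u = lightCov d := by
  rw [← hor_horCoord_of_mem_U hu, lightRow_hor]

lemma U_mul_comm (u v : U d) : u * v = v * u := by
  apply Subtype.ext
  rw [Subgroup.coe_mul, Subgroup.coe_mul, ← hor_horCoord_of_mem_U u.2, ← hor_horCoord_of_mem_U v.2,
    ← hor_add, ← hor_add, add_comm]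

lemma isClosed_U : IsClosed (U d : Set (G d)) := by
  have hU : (U d : Set (G d)) = {u | hor (horCoord u) = u} :=
    Set.ext fun u => ⟨hor_horCoord_of_mem_U, fun hu => hu ▸ hor_mem_U _⟩
  rw [hU]
  exact isClosed_eq (continuous_hor.comp continuous_horCoord) continuous_id

instance : LocallyCompactSpace (U d) := isClosed_U.isClosedEmbedding_subtypeVal.locallyCompactSpace

instance : CompactSpace (M d) :=
  isCompact_iff_compactSpace.mp (isCompact_K.inter_right (Set.isClosed_centralizer _))

lemma conj_mem_U {q u : G d} (hq : q ∈ Subgroup.centralizer (A d : Set (G d))) (hu : u ∈ U d) :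
    q * u * q⁻¹ ∈ U d := by
  have hlim : Tendsto (fun t : ℝ => q * (a d (-t) * u * a d t) * q⁻¹) atTop (𝓝 (q * 1 * q⁻¹)) :=
    (tendsto_const_nhds.mul hu).mul tendsto_const_nhds
  rw [mul_one, mul_inv_cancel] at hlim
  refine hlim.congr fun t => ?_
  calc q * (a d (-t) * u * a d t) * q⁻¹
      = (q * a d (-t)) * u * (a d t * q⁻¹) := by simp only [mul_assoc]
    _ = a d (-t) * (q * u * q⁻¹) * a d t := by
      rw [← mem_centralizer_A_iff.mp hq, mem_centralizer_A_iff.mp (inv_mem hq)]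
      simp only [mul_assoc]

lemma mem_Q_iff {q : G d} : q ∈ Q d ↔ q ∈ lightStabilizer d := by
  refine ⟨fun hq => ?_, fun hq => ?_⟩
  · refine sup_le (sup_le U_le_lightStabilizer ?_) ?_ hq
    · exact M_le_centralizer_A.trans centralizer_A_le_lightStabilizer
    · rintro _ ⟨t, rfl⟩
      exact ⟨_, lightRow_a t⟩
  · rw [← hor_mul_a_mul_kPart q]
    have hU : U d ≤ Q d := le_sup_left.trans le_sup_left
    have hM : M d ≤ Q d := le_sup_right.trans le_sup_left
    have hA : A d ≤ Q d := le_sup_right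
    exact mul_mem (mul_mem (hU (hor_mem_U _)) (hA ⟨_, rfl⟩)) (hM (kPart_mem_M hq))

/-! ### The boundary -/

lemma proj_eq_iff {g h : G d} : proj g = proj h ↔ ∃ c : ℝ, lightRow g = c • lightRow h := by
  have hQ : proj g = proj h ↔ g * h⁻¹ ∈ Q d := by
    rw [eq_comm]
    exact Quotient.eq.trans QuotientGroup.rightRel_apply
  rw [hQ, mem_Q_iff]
  refine exists_congr fun c => ⟨fun hc => ?_, fun hc => ?_⟩
  · rw [← lightRow_mul_of_eq hc, inv_mul_cancel_right]
  · rw [lightRow_mul, hc, Matrix.smul_vecMul, ← lightRow_mul, mul_inv_cancel, lightRow_one]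

lemma proj_mul_of_lightRow {q : G d} {c : ℝ} (hq : lightRow q = c • lightCov d) (g : G d) :
    proj (q * g) = proj g :=
  proj_eq_iff.mpr ⟨c, lightRow_mul_of_eq hq g⟩

lemma proj_kPart (g : G d) : proj (kPart g) = proj g := by
  conv_rhs => rw [← hor_mul_a_mul_kPart g]
  exact (proj_mul_of_lightRow (lightRow_hor_mul_a _ _) _).symm

lemma lightRow_eq_of_mem_K {k k' : G d} (hk : k ∈ K d) (hk' : k' ∈ K d) (h : proj k = proj k') :
    lightRow k = lightRow k' := by
  obtain ⟨c, hc⟩ := proj_eq_iff.mp h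
  have htime := congrFun hc (Sum.inr 1)
  rw [Pi.smul_apply, lightRow_time_of_mem_K hk, lightRow_time_of_mem_K hk', smul_eq_mul] at htime
  rw [hc, show c = 1 by linarith, one_smul]

lemma mul_inv_mem_M {k k' : G d} (hk : k ∈ K d) (hk' : k' ∈ K d) (h : proj k = proj k') :
    k * k'⁻¹ ∈ M d := by
  refine mem_M_of_lightRow ((K d).mul_mem hk ((K d).inv_mem hk')) ?_
  rw [lightRow_mul, lightRow_eq_of_mem_K hk hk' h, ← lightRow_mul, mul_inv_cancel, lightRow_one]

lemma act_proj (g h : G d) : act (proj g) h = proj (g * h) := rfl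

lemma measurable_proj : Measurable (proj : G d → Bdry d) := measurable_quotient_mk''

lemma measurable_act (g : G d) : Measurable fun ξ : Bdry d => act ξ g :=
  measurable_from_quotient.mpr (measurable_proj.comp (measurable_mul_const g))

/-! ### A Borel section -/

/-- The element of the opposite horospherical group with parameter `y`. Its orbit of the base point
covers all of the boundary but one point. -/
def oppHor (y : Fin (d - 1) → ℝ) : G d :=
  ⟨⟨(horMat y).transpose, by rw [Matrix.det_transpose, horMat_det]⟩,
    lorentz_flip (horMat_lorentz y), (hor y).2.2⟩

lemma mat_oppHor (y : Fin (d - 1) → ℝ) : mat (oppHor y) = (mat (hor y)).transpose := rfl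

lemma continuous_oppHor : Continuous (oppHor : (Fin (d - 1) → ℝ) → G d) :=
  continuous_of_mat fun i j => (continuous_mat_apply j i).comp continuous_hor

lemma lightRow_oppHor (y : Fin (d - 1) → ℝ) : lightRow (oppHor y) =
    Sum.elim (fun i => -2 * y i) ![1 - ∑ i, y i ^ 2, -1 - ∑ i, y i ^ 2] := by
  funext j
  rw [lightRow_apply, mat_oppHor, Matrix.transpose_apply, Matrix.transpose_apply, mat_hor]
  induction j using idx_cases <;> simp [horMat] <;> ring

/-- The boundary point `Qg` is the one not covered by the elements `oppHor y`. -/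
def IsPole (g : G d) : Prop := lightRow g (Sum.inr 0) = lightRow g (Sum.inr 1)

/-- The stereographic coordinate of the boundary point `Qg`; it has a junk value at the pole. -/
def stereo (g : G d) : Fin (d - 1) → ℝ :=
  fun i => -lightRow g (Sum.inl i) / (lightRow g (Sum.inr 0) - lightRow g (Sum.inr 1))

lemma measurable_stereo : Measurable (stereo : G d → Fin (d - 1) → ℝ) :=
  measurable_pi_lambda _ fun _ => (continuous_lightRow _).measurable.neg.div
    ((continuous_lightRow _).measurable.sub (continuous_lightRow _).measurable)

lemma proj_oppHor_stereo {g : G d} (hg : ¬IsPole g) : proj (oppHor (stereo g)) = proj g := by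
  have hne : lightRow g (Sum.inr 0) - lightRow g (Sum.inr 1) ≠ 0 := sub_ne_zero.mpr hg
  have hsum : ∑ i, stereo g i ^ 2 = (lightRow g (Sum.inr 1) ^ 2 - lightRow g (Sum.inr 0) ^ 2) /
      (lightRow g (Sum.inr 0) - lightRow g (Sum.inr 1)) ^ 2 := by
    simp only [← lightRow_null g, add_sub_cancel_right, Finset.sum_div, stereo, div_pow, neg_sq]
  refine proj_eq_iff.mpr ⟨2 / (lightRow g (Sum.inr 0) - lightRow g (Sum.inr 1)), ?_⟩
  rw [lightRow_oppHor, hsum]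
  funext j
  simp only [Pi.smul_apply, smul_eq_mul]
  induction j using idx_cases with
  | space i => rw [Sum.elim_inl, stereo]; ring
  | flow => rw [Sum.elim_inr, Matrix.cons_val_zero]; field_simp; ring
  | time => rw [Sum.elim_inr, Matrix.cons_val_one, Matrix.cons_val_fin_one]; field_simp; ring

lemma IsPole.lightRow_space {g : G d} (hg : IsPole g) (i : Fin (d - 1)) :
    lightRow g (Sum.inl i) = 0 := by
  have hnull := lightRow_null g
  rw [hg, add_eq_right, Finset.sum_eq_zero_iff_of_nonneg fun i _ => sq_nonneg _] at hnull
  exact pow_eq_zero_iff two_ne_zero |>.mp (hnull i (Finset.mem_univ i))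

lemma IsPole.proj_eq {g h : G d} (hg : IsPole g) (hh : IsPole h) : proj g = proj h := by
  have hne := (lightRow_time_neg h).ne
  refine proj_eq_iff.mpr ⟨lightRow g (Sum.inr 1) / lightRow h (Sum.inr 1), ?_⟩
  funext j
  rw [Pi.smul_apply, smul_eq_mul]
  induction j using idx_cases with
  | space i => rw [hg.lightRow_space, hh.lightRow_space, mul_zero]
  | flow => rw [hg, hh, div_mul_cancel₀ _ hne]
  | time => rw [div_mul_cancel₀ _ hne]

open Classical in
/-- A representative in `G` of the boundary point `Qg`, depending on this point only: the
opposite horospherical one away from the pole. -/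
def bdryRep (g : G d) : G d := if IsPole g then Classical.epsilon IsPole else oppHor (stereo g)

lemma proj_bdryRep (g : G d) : proj (bdryRep g) = proj g := by
  by_cases hg : IsPole g
  · rw [bdryRep, if_pos hg]
    exact (Classical.epsilon_spec ⟨g, hg⟩ : IsPole (Classical.epsilon IsPole)).proj_eq hg
  · rw [bdryRep, if_neg hg, proj_oppHor_stereo hg]

open Classical in
lemma bdryRep_eq_of_proj_eq {g h : G d} (hgh : proj g = proj h) : bdryRep g = bdryRep h := by
  obtain ⟨c, hc⟩ := proj_eq_iff.mp hgh
  have hc0 : c ≠ 0 := by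
    rintro rfl
    exact (lightRow_time_neg g).ne (by rw [hc, zero_smul, Pi.zero_apply])
  have hpole : IsPole g ↔ IsPole h := by
    simp only [IsPole, hc, Pi.smul_apply, smul_eq_mul, mul_right_inj' hc0]
  have hstereo : stereo g = stereo h := by
    funext i
    simp only [stereo, hc, Pi.smul_apply, smul_eq_mul, ← mul_sub]
    rw [neg_mul_eq_mul_neg, mul_div_mul_left _ _ hc0]
  unfold bdryRep
  rw [hstereo]
  exact if_congr hpole rfl rfl

lemma measurable_bdryRep : Measurable (bdryRep : G d → G d) :=
  Measurable.ite (isClosed_eq (continuous_lightRow _) (continuous_lightRow _)).measurableSet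
    measurable_const (continuous_oppHor.measurable.comp measurable_stereo)

lemma exists_isBorelSection : ∃ s : Bdry d → G d, IsBorelSection s := by
  refine ⟨Quotient.lift (fun g => kPart (bdryRep g)) fun g h hgh => congrArg kPart
    (bdryRep_eq_of_proj_eq (Quotient.sound hgh)), measurable_from_quotient.mpr
    (continuous_kPart.measurable.comp measurable_bdryRep), fun ξ => ?_⟩
  induction ξ using Quotient.inductionOn with
  | h g => exact ⟨kPart_mem_K _, (proj_kPart _).trans (proj_bdryRep g)⟩

/-! ### The coordinates of a section -/

section Coordinates

variable {s : Bdry d → G d}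

lemma coord_eq (s : Bdry d → G d) (p : U d × M d × ℝ × Bdry d) :
    coord s p = hor (horCoord (p.1 : G d)) * a d p.2.2.1 * (p.2.1 * s p.2.2.2) := by
  rw [coord, hor_horCoord_of_mem_U p.1.2, mul_assoc (p.1 : G d),
    ← mem_centralizer_A_iff.mp (M_le_centralizer_A p.2.1.2)]
  simp only [mul_assoc]

lemma mul_section_mem_K (hs : IsBorelSection s) (m : M d) (ξ : Bdry d) : (m : G d) * s ξ ∈ K d :=
  mul_mem (M_le_K m.2) (hs.2 ξ).1

lemma horCoord_coord (hs : IsBorelSection s) (p : U d × M d × ℝ × Bdry d) :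
    horCoord (coord s p) = horCoord (p.1 : G d) := by
  rw [coord_eq, horCoord_hor_mul_a_mul _ _ (mul_section_mem_K hs _ _)]

lemma height_coord (hs : IsBorelSection s) (p : U d × M d × ℝ × Bdry d) :
    height (coord s p) = p.2.2.1 := by
  rw [coord_eq, height_hor_mul_a_mul, height_of_mem_K (mul_section_mem_K hs _ _), add_zero]

lemma kPart_coord (hs : IsBorelSection s) (p : U d × M d × ℝ × Bdry d) :
    kPart (coord s p) = p.2.1 * s p.2.2.2 := by
  rw [kPart, horCoord_coord hs, height_coord hs, coord_eq, inv_mul_cancel_left]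

lemma proj_coord (hs : IsBorelSection s) (p : U d × M d × ℝ × Bdry d) :
    proj (coord s p) = p.2.2.2 := by
  have hm : lightRow (p.2.1 : G d) = (1 : ℝ) • lightCov d := by
    rw [lightRow_of_mem_M p.2.1.2, one_smul]
  rw [← proj_kPart, kPart_coord hs, proj_mul_of_lightRow hm, (hs.2 _).2]

lemma kPart_mul_section_inv_mem_M (hs : IsBorelSection s) (g : G d) :
    kPart g * (s (proj g))⁻¹ ∈ M d :=
  mul_inv_mem_M (kPart_mem_K g) (hs.2 _).1 ((proj_kPart g).trans (hs.2 _).2.symm)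

lemma measurable_coord (hs : IsBorelSection s) : Measurable (coord s) :=
  (((measurable_subtype_coe.comp measurable_fst).mul
    (measurable_subtype_coe.comp (measurable_fst.comp measurable_snd))).mul
    (continuous_a.measurable.comp (measurable_fst.comp (measurable_snd.comp measurable_snd)))).mul
    (hs.1.comp (measurable_snd.comp (measurable_snd.comp measurable_snd)))

/-- The coordinates of a Borel section, as a Borel isomorphism. -/
def coordEquiv (s : Bdry d → G d) (hs : IsBorelSection s) :
    (U d × M d × ℝ × Bdry d) ≃ᵐ G d where
  toFun := coord s
  invFun g := (⟨hor (horCoord g), hor_mem_U _⟩,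
    ⟨kPart g * (s (proj g))⁻¹, kPart_mul_section_inv_mem_M hs g⟩, height g, proj g)
  left_inv p := by
    refine Prod.ext (Subtype.ext ?_) (Prod.ext (Subtype.ext ?_)
      (Prod.ext (height_coord hs p) (proj_coord hs p)))
    · exact (congrArg hor (horCoord_coord hs p)).trans (hor_horCoord_of_mem_U p.1.2)
    · exact mul_inv_eq_of_eq_mul (by rw [kPart_coord hs, proj_coord hs])
  right_inv g := by
    rw [coord_eq, horCoord_hor, inv_mul_cancel_right, hor_mul_a_mul_kPart]
  measurable_toFun := measurable_coord hs
  measurable_invFun :=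
    (continuous_hor.comp continuous_horCoord).measurable.subtype_mk.prodMk
      ((continuous_kPart.measurable.mul (hs.1.comp measurable_proj).inv).subtype_mk.prodMk
        (continuous_height.measurable.prodMk measurable_proj))

end Coordinates

/-! ### The Busemann function -/

lemma isBusemann_height {ξ : Bdry d} {k : G d} (hk : k ∈ K d) (hξ : proj k = ξ) (g : G d) :
    IsBusemann ξ g⁻¹ 1 (height (k * g)) := by
  refine ⟨kPart (k * g), kPart_mem_K _, ?_, k⁻¹, inv_mem hk,
    (a d (height (k * g)))⁻¹ * hor (horCoord (k * g)) * ((a d (height (k * g)))⁻¹)⁻¹, ?_, ?_⟩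
  · rw [← act_proj, proj_kPart, act_proj, mul_inv_cancel_right, hξ]
  · exact conj_mem_U (inv_mem (a_mem_centralizer_A _)) (hor_mem_U _)
  · rw [kPart]
    group

lemma IsBusemann.eq_height {ξ : Bdry d} {k : G d} (hk : k ∈ K d) (hξ : proj k = ξ) {g : G d}
    {b : ℝ} (hb : IsBusemann ξ g⁻¹ 1 b) : b = height (k * g) := by
  obtain ⟨k₀, hk₀, hξ₀, k', hk', u, hu, h⟩ := hb
  have hrow : lightRow (a d b * u) = Real.exp (-b) • lightCov d := by
    rw [lightRow_mul_of_eq (lightRow_a b), lightRow_of_mem_U hu]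
  have hk'' : k'⁻¹ = a d b * u * (k₀ * g⁻¹) := by
    rw [one_mul] at h
    rw [← inv_inv (k₀ * g⁻¹), h]
    group
  have hproj : proj k = proj k'⁻¹ := by rw [hk'', proj_mul_of_lightRow hrow, hξ₀, hξ]
  have hkg : lightRow (k * g) = lightRow (a d b * u * k₀) := by
    rw [lightRow_mul, lightRow_eq_of_mem_K hk (inv_mem hk') hproj, ← lightRow_mul, hk'']
    congr 1
    group
  have hheight : height (a d b * u) = b :=
    (neg_inj.mp (Real.exp_injective (eq_exp_neg_height_of_lightRow_eq hrow))).symm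
  rw [height, hkg, ← height, height_mul_of_eq hrow, height_of_mem_K hk₀, add_zero, hheight]

lemma busemann_eq {ξ : Bdry d} {k : G d} (hk : k ∈ K d) (hξ : proj k = ξ) (g : G d) :
    busemann ξ g⁻¹ 1 = height (k * g) :=
  IsBusemann.eq_height hk hξ (Classical.epsilon_spec ⟨_, isBusemann_height hk hξ g⟩)

/-! ### Conjugation of the horospherical group -/

/-- Conjugation of `U` by an element which commutes with the flow. -/
def conjU (q : Subgroup.centralizer (A d : Set (G d))) : U d ≃ₜ* U d where
  toFun u := ⟨q * u * (q : G d)⁻¹, conj_mem_U q.2 u.2⟩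
  invFun u := ⟨(q : G d)⁻¹ * u * (q : G d)⁻¹⁻¹, conj_mem_U (inv_mem q.2) u.2⟩
  left_inv u := Subtype.ext (by dsimp only; group)
  right_inv u := Subtype.ext (by dsimp only; group)
  map_mul' u v := Subtype.ext (by simp only [Subgroup.coe_mul]; group)
  continuous_toFun :=
    ((continuous_const.mul continuous_subtype_val).mul continuous_const).subtype_mk _
  continuous_invFun :=
    ((continuous_const.mul continuous_subtype_val).mul continuous_const).subtype_mk _

lemma coe_conjU (q : Subgroup.centralizer (A d : Set (G d))) (u : U d) :
    (conjU q u : G d) = q * u * (q : G d)⁻¹ := rfl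

lemma exists_map_conjU_eq_smul (du : Measure (U d)) [du.IsHaarMeasure]
    (q : Subgroup.centralizer (A d : Set (G d))) :
    ∃ k : ENNReal, k ≠ 0 ∧ k ≠ ⊤ ∧ du.map (conjU q) = k • du := by
  have : (du.map (conjU q)).IsHaarMeasure := (conjU q).isHaarMeasure_map du
  exact ⟨Measure.haarScalarFactor (du.map (conjU q)) du,
    ENNReal.coe_ne_zero.mpr (Measure.haarScalarFactor_pos_of_isHaarMeasure _ _).ne',
    ENNReal.coe_ne_top, Measure.isMulLeftInvariant_eq_smul _ du⟩

/-- The product `m a_t`, as an element which commutes with the flow. -/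
def mulA (m : M d) (t : ℝ) : Subgroup.centralizer (A d : Set (G d)) :=
  ⟨m * a d t, mul_mem (M_le_centralizer_A m.2) (a_mem_centralizer_A t)⟩

lemma coe_mulA (m : M d) (t : ℝ) : (mulA m t : G d) = m * a d t := rfl

/-! ### Change of coordinates -/

section ChangeOfCoordinates

/-- For `c : S^{d-1} → U × M × ℝ × S^{d-1}`, the map which expresses the point `u m a_t f(ξ)` in the
coordinates of a section `s`, where `f(ξ)` has the coordinates `c ξ`. -/
def skew (c : Bdry d → U d × M d × ℝ × Bdry d) (p : U d × M d × ℝ × Bdry d) :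
    U d × M d × ℝ × Bdry d :=
  (p.1 * conjU (mulA p.2.1 p.2.2.1) (c p.2.2.2).1, p.2.1 * (c p.2.2.2).2.1,
    p.2.2.1 + (c p.2.2.2).2.2.1, (c p.2.2.2).2.2.2)

lemma coord_skew (s : Bdry d → G d) (c : Bdry d → U d × M d × ℝ × Bdry d)
    (p : U d × M d × ℝ × Bdry d) : coord s (skew c p) = coord (coord s ∘ c) p := by
  obtain ⟨u, m, t, ξ⟩ := p
  obtain ⟨⟨u', m', t', η⟩, hc⟩ : ∃ q, c ξ = q := ⟨_, rfl⟩
  have hcomm : a d t * m' = m' * a d t :=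
    mem_centralizer_A_iff.mp (M_le_centralizer_A m'.2) t
  simp only [coord, skew, Function.comp_apply, hc, Subgroup.coe_mul, coe_conjU, coe_mulA, a_add]
  calc (u : G d) * (m * a d t * u' * (m * a d t : G d)⁻¹) * (m * m') * (a d t * a d t') * s η
      = u * m * a d t * u' * (a d t)⁻¹ * (m' * a d t) * a d t' * s η := by group
    _ = u * m * a d t * (u' * m' * a d t' * s η) := by rw [← hcomm]; group

variable {c : Bdry d → U d × M d × ℝ × Bdry d}

lemma measurable_conjU_mulA (hc : Measurable c) : Measurable fun y : M d × ℝ × Bdry d =>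
    conjU (mulA y.1 y.2.1) (c y.2.2).1 := by
  have hq : Measurable fun y : M d × ℝ × Bdry d => (mulA y.1 y.2.1 : G d) :=
    (measurable_subtype_coe.comp measurable_fst).mul
      (continuous_a.measurable.comp (measurable_fst.comp measurable_snd))
  have hu : Measurable fun y : M d × ℝ × Bdry d => ((c y.2.2).1 : G d) :=
    measurable_subtype_coe.comp (hc.comp (measurable_snd.comp measurable_snd)).fst
  exact ((hq.mul hu).mul hq.inv).subtype_mk

lemma measurable_skew (hc : Measurable c) : Measurable (skew c) := by
  have hcp : Measurable fun p : U d × M d × ℝ × Bdry d => c p.2.2.2 :=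
    hc.comp (measurable_snd.comp (measurable_snd.comp measurable_snd))
  exact (measurable_fst.mul ((measurable_conjU_mulA hc).comp measurable_snd)).prodMk
    ((measurable_snd.fst.mul hcp.snd.fst).prodMk
      ((measurable_snd.snd.fst.add hcp.snd.snd.fst).prodMk hcp.snd.snd.snd))

lemma isMulRightInvariant_U (du : Measure (U d)) [du.IsHaarMeasure] : du.IsMulRightInvariant := by
  refine ⟨fun u => ?_⟩
  rw [funext fun v : U d => U_mul_comm v u, map_mul_left_eq_self]

variable (du : Measure (U d)) [du.IsHaarMeasure] (dm : Measure (M d)) [dm.IsHaarMeasure] (β : ℝ)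

lemma map_skew_coordMeasure (ν : Measure (Bdry d)) [SFinite ν] (hc : Measurable c) :
    (coordMeasure du dm β ν).map (skew c) = coordMeasure du dm β
      ((ν.withDensity fun ξ => expDens β (-(c ξ).2.2.1)).map fun ξ => (c ξ).2.2.2) := by
  have hU := isMulRightInvariant_U du
  have hM := isMulRightInvariant_of_isFiniteMeasure dm
  have hcℝ : Measurable fun y : ℝ × Bdry d => c y.2 := hc.comp measurable_snd
  have hcM : Measurable fun y : M d × ℝ × Bdry d => c y.2.2 := hcℝ.comp measurable_snd
  have hmℝ : Measurable fun y : ℝ × Bdry d => (y.1 + (c y.2).2.2.1, (c y.2).2.2.2) :=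
    (measurable_fst.add hcℝ.snd.snd.fst).prodMk hcℝ.snd.snd.snd
  have hmM : Measurable fun y : M d × ℝ × Bdry d =>
      (y.1 * (c y.2.2).2.1, y.2.1 + (c y.2.2).2.2.1, (c y.2.2).2.2.2) :=
    (measurable_fst.mul hcM.snd.fst).prodMk (hmℝ.comp measurable_snd)
  calc (coordMeasure du dm β ν).map (skew c)
      = du.prod ((dm.prod ((expMeasure β).prod ν)).map fun y =>
          (y.1 * (c y.2.2).2.1, y.2.1 + (c y.2.2).2.2.1, (c y.2.2).2.2.2)) :=
        map_skew_mul_right du _ (measurable_conjU_mulA hc) hmM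
    _ = du.prod (dm.prod (((expMeasure β).prod ν).map fun y =>
          (y.1 + (c y.2).2.2.1, (c y.2).2.2.2))) :=
        congrArg du.prod (map_skew_mul_right dm _ hcℝ.snd.fst hmℝ)
    _ = _ := congrArg (du.prod <| dm.prod ·)
        (map_skew_add_expMeasure β ν hc.snd.snd.fst hc.snd.snd.snd)

lemma coordMeasure_injective {ν ν' : Measure (Bdry d)} [SFinite ν] [SFinite ν']
    (h : coordMeasure du dm β ν = coordMeasure du dm β ν') : ν = ν' :=
  prod_left_cancel (h := expMeasure β) (prod_left_cancel (prod_left_cancel h))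

variable {s : Bdry d → G d}

theorem map_coord_coordMeasure_of_measurable (hs : IsBorelSection s) (ν : Measure (Bdry d))
    [SFinite ν] {f : Bdry d → G d} (hf : Measurable f) :
    (coordMeasure du dm β ν).map (coord f) = (coordMeasure du dm β
      ((ν.withDensity fun ξ => expDens β (-height (f ξ))).map fun ξ => proj (f ξ))).map
      (coord s) := by
  have hc : Measurable fun ξ => (coordEquiv s hs).symm (f ξ) :=
    (coordEquiv s hs).symm.measurable.comp hf
  have hsf : coord s ∘ (fun ξ => (coordEquiv s hs).symm (f ξ)) = f :=
    funext fun ξ => (coordEquiv s hs).apply_symm_apply (f ξ)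
  have hcoord : coord f = coord s ∘ skew fun ξ => (coordEquiv s hs).symm (f ξ) :=
    funext fun p => by rw [Function.comp_apply, coord_skew, hsf]
  rw [hcoord, ← Measure.map_map (measurable_coord hs) (measurable_skew hc),
    map_skew_coordMeasure du dm β ν hc]
  rfl

theorem map_coord_eq_of_isBorelSection (hs : IsBorelSection s) (ν : Measure (Bdry d))
    [SFinite ν] {s' : Bdry d → G d} (hs' : IsBorelSection s') :
    (coordMeasure du dm β ν).map (coord s') = (coordMeasure du dm β ν).map (coord s) := by
  rw [map_coord_coordMeasure_of_measurable du dm β hs ν hs'.1]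
  simp only [height_of_mem_K (hs'.2 _).1, (hs'.2 _).2, neg_zero, expDens_zero, Measure.map_id']
  exact congrArg (fun ν => (coordMeasure du dm β ν).map (coord s)) withDensity_one

end ChangeOfCoordinates

/-! ### Conformality of the boundary measure -/

section Conformal

variable {s : Bdry d → G d}

lemma height_section_mul (hs : IsBorelSection s) (g h : G d) :
    height (s (proj g) * h) = height (g * h) - height g := by
  have hk : height (s (proj g) * h) = height (kPart g * h) :=
    (busemann_eq (hs.2 _).1 (hs.2 _).2 h).symm.trans
      (busemann_eq (kPart_mem_K g) (proj_kPart g) h)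
  have hg := height_hor_mul_a_mul (horCoord g) (height g) (kPart g * h)
  rw [← mul_assoc, hor_mul_a_mul_kPart] at hg
  rw [hk, hg, add_sub_cancel_left]

variable (du : Measure (U d)) [du.IsHaarMeasure] (dm : Measure (M d)) [dm.IsHaarMeasure]
  {β : ℝ} {ν : Measure (Bdry d)}

lemma map_act_withDensity_eq_self [SFinite ν] (hs : IsBorelSection s) {g : G d}
    (hg : ((coordMeasure du dm β ν).map (coord s)).map (· * g) =
      (coordMeasure du dm β ν).map (coord s)) :
    (ν.withDensity fun ξ => expDens β (-height (s ξ * g))).map (fun ξ => act ξ g) = ν := by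
  have hcoord : (· * g) ∘ coord s = coord fun ξ => s ξ * g := funext fun p => mul_assoc _ _ _
  have hact : (fun ξ => proj (s ξ * g)) = fun ξ => act ξ g :=
    funext fun ξ => by rw [← act_proj, (hs.2 ξ).2]
  rw [Measure.map_map (measurable_mul_const g) (measurable_coord hs), hcoord,
    map_coord_coordMeasure_of_measurable du dm β hs ν (hs.1.mul_const g), hact] at hg
  exact coordMeasure_injective du dm β ((coordEquiv s hs).map_measurableEquiv_injective hg)

theorem isConformal_of_map_mul_right [SFinite ν] (hs : IsBorelSection s) {Γ : Subgroup (G d)}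
    (hΓ : ∀ γ ∈ Γ, ((coordMeasure du dm β ν).map (coord s)).map (· * γ) =
      (coordMeasure du dm β ν).map (coord s)) : IsConformal Γ β ν := by
  intro γ hγ
  have hdens : ∀ g, Measurable fun ξ => expDens β (-height (s ξ * g)) := fun g =>
    (measurable_expDens β).comp (continuous_height.measurable.comp (hs.1.mul_const g)).neg
  have hcocycle : ∀ ξ, height (s (act ξ γ⁻¹) * γ) = -height (s ξ * γ⁻¹) := fun ξ => by
    rw [← (hs.2 ξ).2, act_proj, height_section_mul hs, inv_mul_cancel_right, (hs.2 ξ).2,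
      height_of_mem_K (hs.2 ξ).1, zero_sub]
  have hbusemann : (fun ξ => ENNReal.ofReal (Real.exp (-β * busemann ξ γ⁻¹ 1))) =
      fun ξ => expDens β (-height (s ξ * γ)) := by
    funext ξ
    rw [busemann_eq (hs.2 ξ).1 (hs.2 ξ).2, expDens, neg_mul_comm]
  rw [hbusemann]
  refine map_eq_withDensity_of_map_withDensity_eq (measurable_act γ⁻¹) (hdens γ⁻¹) (hdens γ)
    (fun ξ => ?_) (map_act_withDensity_eq_self du dm hs (hΓ γ⁻¹ (inv_mem hγ)))
  rw [hcocycle, ← expDens_add, neg_neg, neg_add_cancel, expDens_zero]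

end Conformal

/-! ### The product structure of a measure on `G` -/

section Product

variable {s : Bdry d → G d} {μt : Measure (G d)}

lemma mul_coord (s : Bdry d → G d) (u : U d) (p : U d × M d × ℝ × Bdry d) :
    u * coord s p = coord s (Prod.map (u * ·) id p) := by
  simp only [coord, Prod.map, Subgroup.coe_mul, id, mul_assoc]

lemma mulA_mul_coord (s : Bdry d → G d) (m : M d) (r : ℝ) (p : U d × M d × ℝ × Bdry d) :
    mulA m r * coord s p =
      coord s (Prod.map (conjU (mulA m r)) (Prod.map (m * ·) (Prod.map (· + r) id)) p) := by
  obtain ⟨u, m', t, ξ⟩ := p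
  have hcomm : a d r * m' = m' * a d r := mem_centralizer_A_iff.mp (M_le_centralizer_A m'.2) r
  simp only [coord, Prod.map, id, Subgroup.coe_mul, coe_conjU, coe_mulA, add_comm t, a_add]
  calc (m * a d r : G d) * (u * m' * a d t * s ξ)
      = m * a d r * u * (a d r)⁻¹ * (a d r * m') * a d t * s ξ := by group
    _ = m * a d r * u * (m * a d r : G d)⁻¹ * (m * m') * (a d r * a d t) * s ξ := by
      rw [hcomm]
      group

lemma map_coordEquiv_symm_of_map_mul_left (hs : IsBorelSection s) {q : G d} {c : ENNReal}
    (hq : μt.map (q * ·) = c • μt) {T : U d × M d × ℝ × Bdry d → U d × M d × ℝ × Bdry d}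
    (hTm : Measurable T) (hT : ∀ p, q * coord s p = coord s (T p)) :
    (μt.map (coordEquiv s hs).symm).map T = c • μt.map (coordEquiv s hs).symm := by
  have hcomp : T ∘ (coordEquiv s hs).symm = (coordEquiv s hs).symm ∘ (q * ·) := by
    funext g
    refine ((coordEquiv s hs).symm_apply_eq.mpr ?_).symm
    exact (congrArg (q * ·) ((coordEquiv s hs).apply_symm_apply g)).symm.trans (hT _)
  rw [Measure.map_map hTm (coordEquiv s hs).symm.measurable, hcomp,
    ← Measure.map_map (coordEquiv s hs).symm.measurable (measurable_const_mul q), hq,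
    Measure.map_smul]

open scoped Pointwise in
lemma map_coordEquiv_symm_lt_top [IsLocallyFiniteMeasure μt] (hs : IsBorelSection s)
    {C : Set (U d)} (hC : IsCompact C) (n : ℕ) :
    μt.map (coordEquiv s hs).symm (C ×ˢ Set.univ ×ˢ strip (Bdry d) n) < ⊤ := by
  have hcompact : IsCompact ((Subtype.val '' C) * (Set.range (Subtype.val : M d → G d)) *
      (a d '' Set.Icc (-n : ℝ) n) * (K d : Set (G d))) :=
    (((hC.image continuous_subtype_val).mul (isCompact_range continuous_subtype_val)).mul
      (isCompact_Icc.image continuous_a)).mul isCompact_K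
  rw [MeasurableEquiv.map_apply]
  refine (measure_mono fun g hg => ?_).trans_lt hcompact.measure_lt_top
  obtain ⟨hu, -, ht, -⟩ := hg
  rw [← (coordEquiv s hs).apply_symm_apply g]
  exact Set.mul_mem_mul (Set.mul_mem_mul (Set.mul_mem_mul ⟨_, hu, rfl⟩ ⟨_, rfl⟩) ⟨_, ht, rfl⟩)
    (hs.2 _).1

lemma exists_map_coordEquiv_symm_eq_prod [IsLocallyFiniteMeasure μt] (hs : IsBorelSection s)
    (du : Measure (U d)) [du.IsHaarMeasure]
    (hU : ∀ u : U d, μt.map ((u : G d) * ·) = μt) :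
    ∃ ρ : Measure (M d × ℝ × Bdry d), (∀ n, ρ (Set.univ ×ˢ strip (Bdry d) n) < ⊤) ∧
      μt.map (coordEquiv s hs).symm = du.prod ρ := by
  refine exists_eq_prod_of_map_mul_left_eq_self du
    (fun n => MeasurableSet.univ.prod (measurableSet_strip n))
    (fun i j hij => Set.prod_mono le_rfl (monotone_strip hij)) ?_
    (fun C hC n => map_coordEquiv_symm_lt_top hs hC n) fun u => ?_
  · rw [← Set.prod_iUnion, iUnion_strip, Set.univ_prod_univ]
  · rw [map_coordEquiv_symm_of_map_mul_left hs (by rw [hU u, one_smul])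
      ((measurable_const_mul u).prodMap measurable_id) (mul_coord s u), one_smul]

lemma exists_map_mulA_eq_smul (hs : IsBorelSection s) {du : Measure (U d)} [du.IsHaarMeasure]
    {ρ : Measure (M d × ℝ × Bdry d)} [SFinite ρ]
    (hρ : μt.map (coordEquiv s hs).symm = du.prod ρ) {m : M d} {r : ℝ} {c : ENNReal}
    (hc : μt.map ((m * a d r : G d) * ·) = c • μt) :
    ∃ c' : ENNReal, ρ.map (Prod.map (m * ·) (Prod.map (· + r) id)) = c' • ρ := by
  have hconj : Measurable (conjU (mulA m r)) := (conjU (mulA m r)).continuous.measurable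
  have hshift : Measurable
      (Prod.map (m * ·) (Prod.map (· + r) id) : M d × ℝ × Bdry d → M d × ℝ × Bdry d) :=
    (measurable_const_mul m).prodMap ((measurable_add_const r).prodMap measurable_id)
  obtain ⟨k, hk0, hkt, hk⟩ := exists_map_conjU_eq_smul du (mulA m r)
  have hmap := map_coordEquiv_symm_of_map_mul_left hs hc (hconj.prodMap hshift)
    (mulA_mul_coord s m r)
  rw [hρ] at hmap
  exact exists_map_eq_smul_of_map_prod_eq_smul hconj hshift hk0 hkt hk hmap

theorem exists_eq_map_coord_coordMeasure [IsLocallyFiniteMeasure μt] (hs : IsBorelSection s)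
    (du : Measure (U d)) [du.IsHaarMeasure] (dm : Measure (M d)) [dm.IsHaarMeasure]
    (hU : ∀ u : U d, μt.map ((u : G d) * ·) = μt)
    (hMA : ∀ (m : M d) (r : ℝ), ∃ c : ENNReal, μt.map ((m * a d r : G d) * ·) = c • μt) :
    ∃ (β : ℝ) (ν : Measure (Bdry d)), IsFiniteMeasure ν ∧
      μt = (coordMeasure du dm β ν).map (coord s) := by
  obtain ⟨ρ, hfin, hρ⟩ := exists_map_coordEquiv_symm_eq_prod hs du hU
  have hσ : SigmaFinite ρ := ⟨⟨⟨fun n => Set.univ ×ˢ strip (Bdry d) n, fun _ => trivial, hfin, by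
    rw [← Set.prod_iUnion, iUnion_strip, Set.univ_prod_univ]⟩⟩⟩
  have hshift (m : M d) (r : ℝ) :
      ∃ c : ENNReal, ρ.map (Prod.map (m * ·) (Prod.map (· + r) id)) = c • ρ :=
    (hMA m r).elim fun _ hc => exists_map_mulA_eq_smul hs hρ hc
  obtain ⟨β, ν, hν, rfl⟩ := exists_eq_prod_expMeasure_prod dm hfin
    (fun m => by simpa only [add_zero] using! hshift m 0)
    (fun r => by simpa only [one_mul] using! hshift 1 r)
  refine ⟨β, ν, hν, ?_⟩
  rw [← (coordEquiv s hs).map_map_symm (ν := μt), hρ]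
  rfl

end Product

/-! ### Quasi-invariance and ergodicity -/

section Quotient

variable {Γ : Subgroup (G d)}

lemma U_smul_eq (u : U d) (x : G d ⧸ Γ) : u • x = (u : G d) • x := by
  induction x using QuotientGroup.induction_on with
  | H g => rfl

instance : MeasurableConstSMul (U d) (G d ⧸ Γ) := ⟨fun u => measurable_const_smul (u : G d)⟩

variable {μ : Measure (G d ⧸ Γ)}

lemma map_U_smul_eq_self [SMulInvariantMeasure (U d) (G d ⧸ Γ) μ] (u : U d) :
    μ.map ((u : G d) • ·) = μ := by
  simpa only [U_smul_eq] using (measurePreserving_smul u μ).map_eq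

lemma exists_map_smul_eq_smul [SigmaFinite μ] [ErgodicSMul (U d) (G d ⧸ Γ) μ]
    (q : Subgroup.centralizer (A d : Set (G d))) (hq : μ.map ((q : G d) • ·) ≪ μ) :
    ∃ c : ENNReal, μ.map ((q : G d) • ·) = c • μ := by
  refine exists_map_eq_smul_of_ergodicSMul (N := U d) (T := MeasurableEquiv.smul (q : G d))
    (fun u => ⟨(conjU q).symm u, fun x => ?_⟩) hq
  have hconj : (u : G d) * q = q * (conjU q).symm u := by
    conv_lhs => rw [← (conjU q).apply_symm_apply u, coe_conjU, inv_mul_cancel_right]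
  simp only [MeasurableEquiv.smul_apply, U_smul_eq, smul_smul, hconj]

theorem exists_liftMeasure_eq_map_coord_coordMeasure [DiscreteTopology Γ]
    [IsLocallyFiniteMeasure μ] [ErgodicSMul (U d) (G d ⧸ Γ) μ] (hMA : IsQuasiInvariantMA μ)
    (du : Measure (U d)) [du.IsHaarMeasure] (dm : Measure (M d)) [dm.IsHaarMeasure]
    {s : Bdry d → G d} (hs : IsBorelSection s) :
    ∃ (β : ℝ) (ν : Measure (Bdry d)), IsFiniteMeasure ν ∧
      liftMeasure μ = (coordMeasure du dm β ν).map (coord s) := by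
  refine exists_eq_map_coord_coordMeasure hs du dm (fun u => ?_) fun m r => ?_
  · have hu : μ.map ((u : G d) • ·) = (1 : ENNReal) • μ := by rw [map_U_smul_eq_self, one_smul]
    rw [map_mul_left_liftMeasure hu, one_smul]
  · obtain ⟨c, hc⟩ := exists_map_smul_eq_smul (mulA m r) (hMA m m.2 r).1
    exact ⟨c, map_mul_left_liftMeasure hc⟩

end Quotient

end HoroMeasure

end

theorem mainTheorem6 (d : ℕ) (hd : 2 ≤ d)
    (Γ : Subgroup (HoroMeasure.G d)) [DiscreteTopology Γ]
    (du : Measure (HoroMeasure.U d)) [du.IsHaarMeasure]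
    (dm : Measure (HoroMeasure.M d)) [dm.IsHaarMeasure]
    (μ : Measure (HoroMeasure.G d ⧸ Γ)) [IsLocallyFiniteMeasure μ]
    [ErgodicSMul (HoroMeasure.U d) (HoroMeasure.G d ⧸ Γ) μ]
    (hMA : HoroMeasure.IsQuasiInvariantMA μ) :
    (∃ s : HoroMeasure.Bdry d → HoroMeasure.G d, HoroMeasure.IsBorelSection s) ∧
    ∃ (μt : Measure (HoroMeasure.G d)) (β : ℝ) (ν : Measure (HoroMeasure.Bdry d)),
      HoroMeasure.IsLift μ μt ∧ IsFiniteMeasure ν ∧ HoroMeasure.IsConformal Γ β ν ∧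
      ∀ s : HoroMeasure.Bdry d → HoroMeasure.G d, HoroMeasure.IsBorelSection s →
        μt = (HoroMeasure.coordMeasure du dm β ν).map (HoroMeasure.coord s) := by
  open HoroMeasure in
  obtain ⟨s, hs⟩ := exists_isBorelSection (d := d)
  obtain ⟨β, ν, hν, hlift⟩ := exists_liftMeasure_eq_map_coord_coordMeasure hMA du dm hs
  refine ⟨⟨s, hs⟩, liftMeasure μ, β, ν, fun f hf => lintegral_liftMeasure μ hf, hν, ?_,
    fun s' hs' => ?_⟩
  · refine isConformal_of_map_mul_right du dm hs fun γ hγ => ?_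
    rw [← hlift, map_mul_right_liftMeasure μ hγ]
  · rw [hlift, map_coord_eq_of_isBorelSection du dm β hs ν hs']
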